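/- Let $N\in\mathbb N$ and let $\mu,\nu$ be Borel probability measures on $\mathbb R^N$. A probability measure $\gamma$ on $\mathbb R^N\times\mathbb R^N$ with marginals $\mu$ and $\nu$, disintegrated as $\gamma(dx,dy)=\mu(dx)\gamma^x(dy)$, is called causal from $\mu$ to $\nu$ if for every $t\in\{1,\dots,N\}$ and every Borel set $B\subseteq\mathbb R^N$ depending on the coordinates $y_1,\dots,y_t$ only, the map $x\mapsto\gamma^x(B)$ coincides $\mu$-a.e. with a Borel function of $(x_1,\dots,x_t)$. It is called bicausal if moreover its image under $(x,y)\mapsto(y,x)$ is causal from $\nu$ to $\mu$. Let $\Pi_c(\mu,\nu)$ and $\Pi_{bc}(\mu,\nu)$ be the sets of causal and of bicausal plans. For a probability measure $\eta$ on $\mathbb R$ let $F_\eta(y)=\eta((-\infty,y])$ and $F_\eta^{-1}(u)=\inf\{y: F_\eta(y)\ge u\}$. For a probability measure $\eta$ on $\mathbb R^N$ let $\eta_t$ be its $t$-th marginal and $\eta^{x_1,\dots,x_{t-1}}$ the regular conditional law of the $t$-th coordinate given the first $t-1$ (for $t=1$ this is $\eta_1$). The Knothe–Rosenblatt rearrangement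 of $\mu$ and $\nu$ is the law of $(X_1^*,\dots,X_N^*,Y_1^*,\dots,Y_N^*)$, where, for independent random variables $U_1,\dots,U_N$ uniform on $[0,1]$, recursively for $t=1,\dots,N$, $$X_t^*=F^{-1}_{\mu^{X_1^*,\dots,X_{t-1}^*}}(U_t),\qquad Y_t^*=F^{-1}_{\nu^{Y_1^*,\dots,Y_{t-1}^*}}(U_t).$$ The Knothe–Rosenblatt map $T=(T^1,\dots,T^N):\mathbb R^N\to\mathbb R^N$ is defined recursively by $$T^t(x)=F^{-1}_{\nu^{T^1(x),\dots,T^{t-1}(x)}}\bigl(F_{\mu^{x_1,\dots,x_{t-1}}}(x_t)\bigr),\qquad t=1,\dots,N.$$ **Theorem.** Let $c:\mathbb R^N\times\mathbb R^N\to\mathbb R\cup\{+\infty\}$ be lower semicontinuous, bounded from below and of the form $c(x,y)=\sum_{t=1}^N c_t(x_t,y_t)$ with $c_t:\mathbb R\times\mathbb R\to\mathbb R\cup\{+\infty\}$, and suppose that $\mu$ is the product of its marginals, $\mu=\mu_1\otimes\dots\otimes\mu_N$. 1. The causal and bicausal optimal transport values coincide: $$\inf_{\gamma\in\Pi_c(\mu,\nu)}\int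 c\,d\gamma=\inf_{\gamma\in\Pi_{bc}(\mu,\nu)}\int c\,d\gamma .$$ 2. If moreover $c_t(x,y)=h_t(x-y)$ with $h_t:\mathbb R\to\mathbb R\cup\{+\infty\}$ convex for every $t$, then the Knothe–Rosenblatt rearrangement of $\mu$ and $\nu$ belongs to $\Pi_c(\mu,\nu)$ and minimizes $\gamma\mapsto\int c\,d\gamma$ over $\Pi_c(\mu,\nu)$. 3. If each $\mu_t$ is atomless, then the Knothe–Rosenblatt rearrangement is induced by the Monge map $T$: $T$ is Borel measurable, $T_*\mu=\nu$, and the rearrangement equals $(\mathrm{id},T)_*\mu$. -/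

import Mathlib

open MeasureTheory ProbabilityTheory Set
open scoped ENNReal

namespace CausalOT

noncomputable section

/-- Real-valued paths with `N` time steps, i.e. `ℝ^N`. -/
abbrev Path (N : ℕ) : Type := Fin N → ℝ

/-- Causality of a transport plan `γ` from its first to its second marginal: for every time `t` and
every event `B` that depends on `y_1, …, y_t` only, `x ↦ γ^x(B)` is measurable with respect to
`x_1, …, x_t`, up to a null set of the first marginal. `Filtration.piLE` is the filtration
generated by the coordinates and `γ.condKernel` the regular disintegration of `γ` given `x`. -/
def IsCausal {N : ℕ} (γ : Measure (Path N × Path N)) [IsFiniteMeasure γ] : Prop :=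
  ∀ (t : Fin N) (B : Set (Path N)),
    MeasurableSet[Filtration.piLE (X := fun _ : Fin N => ℝ) t] B →
      ∃ g : Path N → ℝ≥0∞, Measurable[Filtration.piLE (X := fun _ : Fin N => ℝ) t] g ∧
        (fun x => γ.condKernel x B) =ᵐ[γ.fst] g

/-- The causal transport plans from `μ` to `ν`. -/
def causalPlans {N : ℕ} (μ ν : Measure (Path N)) : Set (Measure (Path N × Path N)) :=
  {γ | ∃ _ : IsProbabilityMeasure γ, γ.fst = μ ∧ γ.snd = ν ∧ IsCausal γ}

/-- The bicausal transport plans between `μ` and `ν`. -/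
def bicausalPlans {N : ℕ} (μ ν : Measure (Path N)) : Set (Measure (Path N × Path N)) :=
  {γ | γ ∈ causalPlans μ ν ∧ γ.map Prod.swap ∈ causalPlans ν μ}

/-- The integral `∫ c dγ` of an extended real function, as the integral of the positive part minus
the integral of the negative part. The latter is finite when `c` is bounded below and `γ` is a
probability measure. -/
def transportCost {Ω : Type*} [MeasurableSpace Ω] (c : Ω → EReal) (γ : Measure Ω) : EReal :=
  ((∫⁻ p, (c p).toENNReal ∂γ : ℝ≥0∞) : EReal) - ((∫⁻ p, (-c p).toENNReal ∂γ : ℝ≥0∞) : EReal)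

/-- The value of the causal optimal transport problem. -/
def causalValue {N : ℕ} (c : Path N × Path N → EReal) (μ ν : Measure (Path N)) : EReal :=
  ⨅ γ ∈ causalPlans μ ν, transportCost c γ

/-- The value of the bicausal optimal transport problem. -/
def bicausalValue {N : ℕ} (c : Path N × Path N → EReal) (μ ν : Measure (Path N)) : EReal :=
  ⨅ γ ∈ bicausalPlans μ ν, transportCost c γ

/-- Convexity of a function on the line with values in `(-∞, +∞]` (in `EReal`, `0 * ⊤ = 0`). -/
def IsConvex (h : ℝ → EReal) : Prop :=
  ∀ x y a b : ℝ, 0 ≤ a → 0 ≤ b → a + b = 1 →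
    h (a * x + b * y) ≤ (a : EReal) * h x + (b : EReal) * h y

/-- The left-continuous generalized inverse `F_η⁻¹(u) = inf {y | F_η(y) ≥ u}` of the distribution
function of `η`. -/
def quantile (η : Measure ℝ) (u : ℝ) : ℝ :=
  sInf {y : ℝ | u ≤ cdf η y}

/-- The conditional law `η^{x_1, …, x_{t-1}}(dx_t)` of the coordinate `t` given the strictly earlier
ones. For the first time index, the conditioning space has one point and this is the law of the
first coordinate. -/
def condLaw {N : ℕ} (η : Measure (Path N)) [IsFiniteMeasure η] (t : Fin N) :
    Kernel (Iio t → ℝ) ℝ :=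
  condDistrib (fun x : Path N => x t) (fun (x : Path N) (i : Iio t) => x i) η

/-- The quantile transform of `η`: `Z_t = F⁻¹_{η^{Z_1, …, Z_{t-1}}}(u_t)`, recursively in `t`. -/
def quantileTransform {N : ℕ} (η : Measure (Path N)) [IsFiniteMeasure η] (u : Fin N → ℝ)
    (t : Fin N) : ℝ :=
  quantile (condLaw η t fun i : Iio t => quantileTransform η u i.1) (u t)
termination_by t.val
decreasing_by exact i.2

/-- The law of `N` independent random variables, uniform on `[0, 1]`. -/
def uniformCube (N : ℕ) : Measure (Fin N → ℝ) :=
  Measure.pi fun _ => volume.restrict (Icc (0 : ℝ) 1)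

/-- The Knothe–Rosenblatt rearrangement of `μ` and `ν`: the law of `(X*, Y*)`, the quantile
transforms of `μ` and `ν` driven by the same independent uniform random variables. -/
def knotheRosenblatt {N : ℕ} (μ ν : Measure (Path N)) [IsFiniteMeasure μ] [IsFiniteMeasure ν] :
    Measure (Path N × Path N) :=
  (uniformCube N).map fun u => (quantileTransform μ u, quantileTransform ν u)

/-- The Knothe–Rosenblatt map:
`T^t(x) = F⁻¹_{ν^{T^1(x), …, T^{t-1}(x)}} (F_{μ^{x_1, …, x_{t-1}}}(x_t))`, recursively in `t`. -/
def knotheRosenblattMap {N : ℕ} (μ ν : Measure (Path N)) [IsFiniteMeasure μ] [IsFiniteMeasure ν]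
    (x : Path N) (t : Fin N) : ℝ :=
  quantile (condLaw ν t fun i : Iio t => knotheRosenblattMap μ ν x i.1)
    (cdf (condLaw μ t fun i : Iio t => x i) (x t))
termination_by t.val
decreasing_by exact i.2

end

end CausalOT

open CausalOT

namespace CausalOT

/-! ### Quantile functions on the line. -/

section

open Filter Topology

/-! The cost is a sum over coordinates, so only the joint laws of the pairs (X_t, Y_t) matter. Under
a causal plan the law of Y_{<t} given X depends on X_{<t} only; when μ is a product, X_t is
independent of X_{<t}, hence of Y_{<t} (`IsCausal.map_past_prod`). Given Y_{<t}, the pair (X_t, Y_t)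
is therefore a coupling of μ_t and ν^{Y_{<t}}. Everything follows from this.

Equal values: keep Y and redraw each X_t from its law given Y_{≤t}, with independent noise. The law
of each (X_t, Y_t) is unchanged, hence so is the cost, and the new plan is bicausal
(`resampledPlan_mem_bicausalPlans`).

Optimality: given Y_{<t}, the coupling of μ_t and ν^{Y_{<t}} costs at least as much as the
comonotone one, since h_t is convex (`comonotoneOptimal_of_convex_lsc`). The Knothe–Rosenblatt
rearrangement attains this bound in every coordinate: X*_t is the μ_t-quantile of U_t, and U_t is
independent of Y*_{<t}.

Monge map: without atoms F_{μ_t}(X*_t) = U_t almost surely, so T(X*) = Y* by induction on t.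

Causality is always checked through `FirstMarkov`. If B depends on y_{≤t}, the measure γ(· × B) has
the same conditional laws after time t as the first marginal, so its density, which is x ↦ γ^x(B),
is a function of x_{≤t} (`isCausal_of_firstMarkov`). -/

theorem quantile_le_iff (η : Measure ℝ) {u : ℝ} (hu : 0 < u)
    (hne : {y : ℝ | u ≤ cdf η y}.Nonempty) (y : ℝ) : quantile η u ≤ y ↔ u ≤ cdf η y := by
  have hbdd : BddBelow {y : ℝ | u ≤ cdf η y} := by
    obtain ⟨a, ha⟩ := ((tendsto_cdf_atBot η).eventually (gt_mem_nhds hu)).exists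
    exact ⟨a, fun b hb => le_of_not_gt fun h => absurd ((monotone_cdf η) h.le) (by
      simp only [mem_ofPred_eq] at hb; linarith)⟩
  refine ⟨fun h => ?_, fun h => csInf_le hbdd h⟩
  -- Right-continuity puts the infimum itself in the level set.
  have hright : Tendsto (cdf η) (𝓝[>] y) (𝓝 (cdf η y)) :=
    ((cdf η).right_continuous y).tendsto.mono_left (nhdsWithin_mono _ Ioi_subset_Ici_self)
  refine ge_of_tendsto hright ?_
  filter_upwards [self_mem_nhdsWithin] with z hz
  obtain ⟨w, hw, hwz⟩ := exists_lt_of_csInf_lt hne (lt_of_le_of_lt h hz)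
  exact le_trans hw (monotone_cdf η hwz.le)

theorem quantile_le_iff_of_mem_Ioo (η : Measure ℝ) {u : ℝ} (hu : u ∈ Ioo (0 : ℝ) 1) (y : ℝ) :
    quantile η u ≤ y ↔ u ≤ cdf η y := by
  refine quantile_le_iff η hu.1 ?_ y
  obtain ⟨a, ha⟩ := ((tendsto_cdf_atTop η).eventually (lt_mem_nhds hu.2)).exists
  exact ⟨a, ha.le⟩

theorem measurable_cdf_kernel {α : Type*} [MeasurableSpace α] (κ : Kernel α ℝ) [IsMarkovKernel κ] :
    Measurable fun p : α × ℝ => cdf (κ p.1) p.2 := by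
  have h : Measurable fun p : α × ℝ =>
      (κ.prodMkRight ℝ) p (Prod.mk p ⁻¹' {q : (α × ℝ) × ℝ | q.2 ≤ q.1.2}) :=
    Kernel.measurable_kernel_prodMk_left
      (measurableSet_le measurable_snd (measurable_snd.comp measurable_fst))
  convert h.ennreal_toReal using 2 with p
  rw [cdf_eq_real]
  rfl

theorem measurable_quantile_kernel {α : Type*} [MeasurableSpace α] (κ : Kernel α ℝ)
    [IsMarkovKernel κ] : Measurable fun p : α × ℝ => quantile (κ p.1) p.2 := by
  have hF := measurable_cdf_kernel κ
  have hFy : ∀ y : ℝ, MeasurableSet {p : α × ℝ | p.2 ≤ cdf (κ p.1) y} := fun y =>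
    measurableSet_le measurable_snd (hF.comp (measurable_fst.prodMk measurable_const))
  -- On S the infimum is genuine. Off S the level set is empty or the whole line, and `sInf` takes
  -- its default value 0 in both cases.
  set S : Set (α × ℝ) := {p | 0 < p.2} ∩ ⋃ n : ℕ, {p : α × ℝ | p.2 ≤ cdf (κ p.1) n} with hS
  have hSm : MeasurableSet S :=
    (measurableSet_lt measurable_const measurable_snd).inter (MeasurableSet.iUnion fun n => hFy n)
  have hout : ∀ p ∉ S, quantile (κ p.1) p.2 = 0 := by
    intro p hp
    unfold quantile
    by_cases h0 : 0 < p.2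
    · have : {y : ℝ | p.2 ≤ cdf (κ p.1) y} = ∅ := by
        ext y
        simp only [mem_ofPred_eq, mem_empty_iff_false, iff_false]
        intro hy
        obtain ⟨n, hn⟩ := exists_nat_ge y
        exact hp ⟨h0, mem_iUnion.2 ⟨n, hy.trans (monotone_cdf _ hn)⟩⟩
      rw [this, Real.sInf_empty]
    · have : {y : ℝ | p.2 ≤ cdf (κ p.1) y} = univ := by
        ext y
        simpa using (not_lt.1 h0).trans (cdf_nonneg _ y)
      rw [this, Real.sInf_univ]
  refine measurable_of_Iic fun y => ?_
  have : (fun p : α × ℝ => quantile (κ p.1) p.2) ⁻¹' Iic y =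
      (S ∩ {p | p.2 ≤ cdf (κ p.1) y}) ∪ (Sᶜ ∩ {_p | (0 : ℝ) ≤ y}) := by
    ext p
    by_cases hp : p ∈ S
    · obtain ⟨h0, hn⟩ := id hp
      obtain ⟨n, hn⟩ := mem_iUnion.1 hn
      simp [hp, quantile_le_iff (κ p.1) h0 ⟨n, hn⟩ y]
    · simp [hp, hout p hp]
  rw [this]
  exact (hSm.inter (hFy y)).union (hSm.compl.inter (MeasurableSet.const _))

theorem measurable_quantile (η : Measure ℝ) [IsProbabilityMeasure η] : Measurable (quantile η) :=
  (measurable_quantile_kernel (Kernel.const Unit η)).comp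
    ((measurable_const (a := ())).prodMk measurable_id)

/-- The uniform law on `[0, 1]`. -/
noncomputable abbrev unif : Measure ℝ := volume.restrict (Icc (0 : ℝ) 1)

instance : IsProbabilityMeasure unif := ⟨by simp⟩

theorem ae_unif_mem_Ioo : ∀ᵐ u ∂unif, u ∈ Ioo (0 : ℝ) 1 := by
  rw [unif, ← restrict_Ioo_eq_restrict_Icc]
  exact ae_restrict_mem measurableSet_Ioo

theorem map_quantile_unif (η : Measure ℝ) [IsProbabilityMeasure η] :
    unif.map (quantile η) = η := by
  have := Measure.isProbabilityMeasure_map (μ := unif) (measurable_quantile η).aemeasurable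
  refine Measure.ext_of_Iic _ _ fun y => ?_
  rw [Measure.map_apply (measurable_quantile η) measurableSet_Iic, ← ofReal_cdf η y]
  have : (quantile η ⁻¹' Iic y : Set ℝ) =ᵐ[unif] Iic (cdf η y) := by
    filter_upwards [ae_unif_mem_Ioo] with u hu
    exact propext (quantile_le_iff_of_mem_Ioo η hu y)
  rw [measure_congr this, unif, Measure.restrict_apply measurableSet_Iic]
  have : Iic (cdf η y) ∩ Icc 0 1 = Icc 0 (cdf η y) := by
    ext u
    simp only [mem_inter_iff, mem_Iic, mem_Icc]
    have := cdf_le_one η y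
    constructor
    · rintro ⟨h1, h2, h3⟩; exact ⟨h2, h1⟩
    · rintro ⟨h1, h2⟩; exact ⟨h2, h1, h2.trans this⟩
  rw [this, Real.volume_Icc, sub_zero]

/-- Without atoms the distribution function is continuous; it is below u to the left of the
quantile, hence at most u there. -/
theorem cdf_quantile (η : Measure ℝ) [IsProbabilityMeasure η] (hη : ∀ a, η {a} = 0) {u : ℝ}
    (hu : u ∈ Ioo (0 : ℝ) 1) : cdf η (quantile η u) = u := by
  refine le_antisymm ?_ ((quantile_le_iff_of_mem_Ioo η hu _).1 le_rfl)
  have hcont : ContinuousAt (cdf η) (quantile η u) := by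
    rw [(monotone_cdf η).continuousAt_iff_leftLim_eq_rightLim, (cdf η).rightLim_eq]
    have h := (cdf η).measure_singleton (quantile η u)
    rw [measure_cdf, hη] at h
    exact le_antisymm ((monotone_cdf η).leftLim_le le_rfl)
      (sub_nonpos.1 (ENNReal.ofReal_eq_zero.1 h.symm))
  refine le_of_tendsto (hcont.tendsto.mono_left (nhdsWithin_le_nhds (s := Iio (quantile η u)))) ?_
  filter_upwards [self_mem_nhdsWithin] with z hz
  exact (not_le.1 fun h => absurd ((quantile_le_iff_of_mem_Ioo η hu z).2 h) (not_le.2 hz)).le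

end

/-! ### One-dimensional transport: optimality of the comonotone coupling for convex costs. -/

section

open Filter Topology
open scoped NNReal

/-- Among all couplings of two laws on the line, the comonotone one minimises the expectation of
`f (x - y)`. -/
def ComonotoneOptimal (f : ℝ → ℝ≥0∞) : Prop :=
  ∀ (K : Measure (ℝ × ℝ)) [IsProbabilityMeasure K],
    ∫⁻ u, f (quantile K.fst u - quantile K.snd u) ∂unif ≤ ∫⁻ p, f (p.1 - p.2) ∂K

/-- The positive part of X - Y - s is the length of [Y + s, X); apply Tonelli. -/
theorem lintegral_hinge_eq {Ω : Type*} [MeasurableSpace Ω] (P : Measure Ω) [SFinite P]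
    {X Y : Ω → ℝ} (hX : Measurable X) (hY : Measurable Y) (s : ℝ) :
    ∫⁻ ω, ENNReal.ofReal (X ω - Y ω - s) ∂P = ∫⁻ v, P {ω | Y ω ≤ v - s ∧ v < X ω} := by
  have hS : MeasurableSet {p : Ω × ℝ | Y p.1 ≤ p.2 - s ∧ p.2 < X p.1} :=
    (measurableSet_le (hY.comp measurable_fst) (measurable_snd.sub_const s)).inter
      (measurableSet_lt measurable_snd (hX.comp measurable_fst))
  have h1 := Measure.prod_apply (μ := P) (ν := (volume : Measure ℝ)) hS
  rw [Measure.prod_apply_symm hS] at h1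
  refine Eq.trans (lintegral_congr fun ω => ?_) h1.symm
  have : Prod.mk ω ⁻¹' {p : Ω × ℝ | Y p.1 ≤ p.2 - s ∧ p.2 < X p.1} = Ico (Y ω + s) (X ω) := by
    ext v
    simp [le_sub_iff_add_le]
  rw [this, Real.volume_Ico, sub_sub]

/-- Every coupling satisfies P(Y ≤ v - s, X > v) ≥ P(Y ≤ v - s) - P(X ≤ v), and the comonotone
coupling attains the positive part of this bound for all v at once. -/
theorem comonotoneOptimal_hinge (s : ℝ) :
    ComonotoneOptimal fun z => ENNReal.ofReal (z - s) := by
  intro K _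
  have hX := measurable_quantile K.fst
  have hY := measurable_quantile K.snd
  rw [lintegral_hinge_eq unif hX hY, lintegral_hinge_eq K measurable_fst measurable_snd]
  refine lintegral_mono fun v => ?_
  have h1 : ({u | quantile K.snd u ≤ v - s ∧ v < quantile K.fst u} : Set ℝ) =ᵐ[unif]
      Ioc (cdf K.fst v) (cdf K.snd (v - s)) := by
    filter_upwards [ae_unif_mem_Ioo] with u hu
    refine propext ?_
    change (quantile K.snd u ≤ v - s ∧ v < quantile K.fst u) ↔ _ < u ∧ u ≤ _
    rw [quantile_le_iff_of_mem_Ioo _ hu, ← not_le, quantile_le_iff_of_mem_Ioo _ hu, not_le,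
      and_comm]
  have h2 : unif {u | quantile K.snd u ≤ v - s ∧ v < quantile K.fst u} ≤
      K.snd (Iic (v - s)) - K.fst (Iic v) := by
    rw [measure_congr h1, ← ofReal_cdf K.snd, ← ofReal_cdf K.fst,
      ← ENNReal.ofReal_sub _ (cdf_nonneg _ _), ← Real.volume_Ioc]
    exact Measure.restrict_apply_le _ _
  refine h2.trans ?_
  rw [Measure.snd_apply measurableSet_Iic, Measure.fst_apply measurableSet_Iic]
  refine le_measure_sdiff.trans (measure_mono fun p hp => ?_)
  exact ⟨hp.1, not_le.1 hp.2⟩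

theorem ComonotoneOptimal.comp_neg {f : ℝ → ℝ≥0∞} (hf : ComonotoneOptimal f)
    (hm : Measurable f) : ComonotoneOptimal fun z => f (-z) := by
  intro K _
  have := Measure.isProbabilityMeasure_map (μ := K) measurable_swap.aemeasurable
  have h := hf (K.map Prod.swap)
  rw [lintegral_map (by fun_prop) measurable_swap, Measure.fst_map_swap, Measure.snd_map_swap] at h
  simpa using h

theorem ComonotoneOptimal.add {f g : ℝ → ℝ≥0∞} (hf : ComonotoneOptimal f)
    (hg : ComonotoneOptimal g) (hm : Measurable f) : ComonotoneOptimal fun z => f z + g z := by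
  intro K _
  have hX := measurable_quantile K.fst
  have hY := measurable_quantile K.snd
  beta_reduce
  rw [lintegral_add_left (by fun_prop), lintegral_add_left (by fun_prop)]
  exact add_le_add (hf K) (hg K)

theorem comonotoneOptimal_const (a : ℝ≥0∞) : ComonotoneOptimal fun _ => a := by
  intro K _
  simp

/-- Up to its endpoint a nonempty A is a half-line, so the length is a hinge at inf A. -/
theorem comonotoneOptimal_volume_upperSet {A : Set ℝ} (hA : IsUpperSet A) (hb : BddBelow A) :
    ComonotoneOptimal fun z => volume (A ∩ Iio z) := by
  rcases A.eq_empty_or_nonempty with rfl | hne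
  · simpa using comonotoneOptimal_const 0
  · have h : ∀ z, volume (A ∩ Iio z) = ENNReal.ofReal (z - sInf A) := by
      intro z
      have h1 : Ioi (sInf A) ⊆ A := fun w hw => by
        obtain ⟨a, ha, haw⟩ := exists_lt_of_csInf_lt hne hw
        exact hA haw.le ha
      refine le_antisymm ?_ ?_
      · rw [← Real.volume_Ico]
        exact measure_mono fun w hw => ⟨csInf_le hb hw.1, hw.2⟩
      · rw [← Real.volume_Ioo]
        exact measure_mono fun w hw => ⟨h1 hw.1, hw.2⟩
    simp_rw [h]
    exact comonotoneOptimal_hinge _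

theorem ComonotoneOptimal.lintegral {T : Type*} [MeasurableSpace T] (m : Measure T) [SFinite m]
    {f : T → ℝ → ℝ≥0∞} (hf : ∀ τ, ComonotoneOptimal (f τ))
    (hm : Measurable fun p : T × ℝ => f p.1 p.2) :
    ComonotoneOptimal fun z => ∫⁻ τ, f τ z ∂m := by
  intro K _
  have hq : Measurable fun u => quantile K.fst u - quantile K.snd u :=
    (measurable_quantile K.fst).sub (measurable_quantile K.snd)
  have hd : Measurable fun p : ℝ × ℝ => p.1 - p.2 := measurable_fst.sub measurable_snd
  have h1 : Measurable (Function.uncurry fun (u : ℝ) τ =>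
      f τ (quantile K.fst u - quantile K.snd u)) :=
    hm.comp (measurable_snd.prodMk (hq.comp measurable_fst))
  have h2 : Measurable (Function.uncurry fun (p : ℝ × ℝ) τ => f τ (p.1 - p.2)) :=
    hm.comp (measurable_snd.prodMk (hd.comp measurable_fst))
  beta_reduce
  rw [lintegral_lintegral_swap h1.aemeasurable, lintegral_lintegral_swap h2.aemeasurable]
  exact lintegral_mono fun τ => hf τ K

/-- Layer cake in the values of D: superlevel sets of a monotone function are upper sets, so the
primitive is a mixture of hinges. -/
theorem comonotoneOptimal_primitive {D : ℝ → ℝ} (hD : Monotone D) (z₀ : ℝ) :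
    ComonotoneOptimal fun z => ∫⁻ w in Ioo z₀ z, ENNReal.ofReal (D w) := by
  have hm : Measurable D := hD.measurable
  have hS : MeasurableSet {p : (ℝ × ℝ) × ℝ | (p.2 ∈ Ioi z₀ ∧ p.1.1 < D p.2) ∧ p.2 < p.1.2} :=
    ((measurableSet_Ioi.preimage measurable_snd).inter
      (measurableSet_lt (measurable_fst.comp measurable_fst) (hm.comp measurable_snd))).inter
      (measurableSet_lt measurable_snd (measurable_snd.comp measurable_fst))
  have key := ComonotoneOptimal.lintegral (volume.restrict (Ioi (0 : ℝ)))
    (f := fun τ z => volume ({w | w ∈ Ioi z₀ ∧ τ < D w} ∩ Iio z))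
    (fun τ => comonotoneOptimal_volume_upperSet
      (fun a b hab ha => ⟨lt_of_lt_of_le ha.1 hab, ha.2.trans_le (hD hab)⟩)
      ⟨z₀, fun a ha => le_of_lt ha.1⟩)
    (measurable_measure_prodMk_left (ν := (volume : Measure ℝ)) hS)
  have heq : ∀ z, ∫⁻ w in Ioo z₀ z, ENNReal.ofReal (D w) =
      ∫⁻ τ in Ioi (0 : ℝ), volume ({w | w ∈ Ioi z₀ ∧ τ < D w} ∩ Iio z) := by
    intro z
    have h1 : ∀ w, ENNReal.ofReal (D w) = ENNReal.ofReal (max (D w) 0) := fun w => by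
      rw [ENNReal.ofReal_max, ENNReal.ofReal_zero, max_eq_left (zero_le)]
    simp_rw [h1]
    rw [lintegral_eq_lintegral_meas_lt (f := fun w => max (D w) 0) _
      (ae_of_all _ fun w => le_max_right _ _) (hm.max measurable_const).aemeasurable]
    refine setLIntegral_congr_fun measurableSet_Ioi fun τ hτ => ?_
    have hms : MeasurableSet {w | τ < max (D w) 0} :=
      measurableSet_lt measurable_const (hm.max measurable_const)
    rw [Measure.restrict_apply hms]
    congr 1
    ext w
    have : τ < max (D w) 0 ↔ τ < D w := by
      rw [lt_max_iff]
      exact ⟨fun h => h.resolve_right (not_lt.2 (le_of_lt hτ)), Or.inl⟩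
    simp only [mem_inter_iff, mem_ofPred_eq, mem_Ioo, mem_Ioi, mem_Iio, this]
    tauto
  simp_rw [heq]
  exact key

theorem ofReal_sub_eq_lintegral_rightDeriv {φ : ℝ → ℝ} (hφ : ConvexOn ℝ univ φ) {z₀ : ℝ}
    (hmin : ∀ z, φ z₀ ≤ φ z) {z : ℝ} (hz : z₀ ≤ z) :
    ENNReal.ofReal (φ z - φ z₀) =
      ∫⁻ w in Ioo z₀ z, ENNReal.ofReal (derivWithin φ (Ioi w) w) := by
  have hmono : Monotone fun w => derivWithin φ (Ioi w) w := by
    have := hφ.monotoneOn_rightDeriv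
    rwa [interior_univ, monotoneOn_univ] at this
  have hint : IntervalIntegrable (fun w => derivWithin φ (Ioi w) w) volume z₀ z :=
    hmono.intervalIntegrable
  have hcont : Continuous φ := by
    rw [← continuousOn_univ]
    exact hφ.continuousOn isOpen_univ
  have hftc := intervalIntegral.integral_eq_sub_of_hasDeriv_right hcont.continuousOn
    (fun w _ => hφ.hasDerivWithinAt_rightDeriv_of_mem_interior (by simp)) hint
  -- To the right of a minimiser the right derivative is nonnegative, so `ENNReal.ofReal` loses
  -- nothing.
  have h0 : 0 ≤ derivWithin φ (Ioi z₀) z₀ := by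
    rw [hφ.rightDeriv_eq_sInf_slope_of_mem_interior (by simp)]
    refine Real.sInf_nonneg ?_
    rintro _ ⟨y, hy, rfl⟩
    rw [slope_def_field]
    exact div_nonneg (sub_nonneg.2 (hmin y)) (sub_nonneg.2 (le_of_lt hy.2))
  rw [← hftc, intervalIntegral.integral_of_le hz, integral_Ioc_eq_integral_Ioo]
  refine ofReal_integral_eq_lintegral_ofReal ?_ ?_
  · exact ((intervalIntegrable_iff_integrableOn_Ioc_of_le hz).1 hint).mono_set Ioo_subset_Ioc_self
  · refine (ae_restrict_mem measurableSet_Ioo).mono fun w hw => ?_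
    exact h0.trans (hmono hw.1.le)

/-- Cut at the minimiser. The right branch is a primitive of the right derivative, the left branch
is one after reflection, and each vanishes on the other side because its interval of integration is
empty. -/
theorem comonotoneOptimal_convex_of_min {φ : ℝ → ℝ} (hφ : ConvexOn ℝ univ φ) {z₀ : ℝ}
    (hmin : ∀ z, φ z₀ ≤ φ z) : ComonotoneOptimal fun z => ENNReal.ofReal (φ z - φ z₀) := by
  have hneg : ConvexOn ℝ univ fun z => φ (-z) := by
    have := hφ.comp_linearMap (-LinearMap.id : ℝ →ₗ[ℝ] ℝ)
    simpa [Function.comp_def] using this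
  have mono : ∀ {ψ : ℝ → ℝ}, ConvexOn ℝ univ ψ → Monotone fun w => derivWithin ψ (Ioi w) w := by
    intro ψ hψ
    have := hψ.monotoneOn_rightDeriv
    rwa [interior_univ, monotoneOn_univ] at this
  have meas : ∀ (D : ℝ → ℝ) (a : ℝ),
      Measurable fun z => ∫⁻ w in Ioo a z, ENNReal.ofReal (D w) := fun D a =>
    Monotone.measurable fun x y hxy =>
      lintegral_mono_set (Ioo_subset_Ioo_right hxy)
  have h1 := comonotoneOptimal_primitive (mono hφ) z₀
  have h2 := (comonotoneOptimal_primitive (mono hneg) (-z₀)).comp_neg (meas _ _)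
  convert h1.add h2 (meas _ _) using 2 with z
  rcases le_total z₀ z with hz | hz
  · rw [ofReal_sub_eq_lintegral_rightDeriv hφ hmin hz, Ioo_eq_empty (a := -z₀) (by simpa using hz)]
    simp
  · have := ofReal_sub_eq_lintegral_rightDeriv hneg (z₀ := -z₀) (by simpa using fun z => hmin (-z))
      (neg_le_neg hz)
    simp only [neg_neg] at this
    rw [this, Ioo_eq_empty (a := z₀) (by simpa using hz)]
    simp

theorem comonotoneOptimal_convex_real {φ : ℝ → ℝ} (hφ : ConvexOn ℝ univ φ) (h0 : ∀ z, 0 ≤ φ z) :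
    ComonotoneOptimal fun z => ENNReal.ofReal (φ z) := by
  intro K _
  refine ENNReal.le_of_forall_pos_le_add fun ε hε _ => ?_
  have hcont : Continuous φ := by
    rw [← continuousOn_univ]
    exact hφ.continuousOn isOpen_univ
  -- The infimum need not be attained. Truncating φ from below at φ zε creates the minimiser zε and
  -- changes φ by at most ε.
  obtain ⟨zε, hz⟩ := exists_lt_of_ciInf_lt (lt_add_of_pos_right (⨅ z, φ z) (NNReal.coe_pos.2 hε))
  have hb : BddBelow (range φ) := ⟨0, by rintro _ ⟨z, rfl⟩; exact h0 z⟩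
  have hψ : ConvexOn ℝ univ (φ ⊔ fun _ => φ zε) := hφ.sup (convexOn_const _ convex_univ)
  have hψm : ∀ z, (φ ⊔ fun _ => φ zε) zε ≤ (φ ⊔ fun _ => φ zε) z := fun z => by simp
  have h := (comonotoneOptimal_convex_of_min hψ hψm).add
    (comonotoneOptimal_const (ENNReal.ofReal (φ zε)))
    ((hcont.max continuous_const).sub continuous_const).measurable.ennreal_ofReal
  have heq : ∀ z, ENNReal.ofReal ((φ ⊔ fun _ => φ zε) z - (φ ⊔ fun _ => φ zε) zε) +
      ENNReal.ofReal (φ zε) = ENNReal.ofReal (max (φ z) (φ zε)) := by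
    intro z
    rw [← ENNReal.ofReal_add (sub_nonneg.2 (hψm z)) (h0 _)]
    simp
  simp_rw [heq] at h
  calc ∫⁻ u, ENNReal.ofReal (φ (quantile K.fst u - quantile K.snd u)) ∂unif
      ≤ ∫⁻ u, ENNReal.ofReal (max (φ (quantile K.fst u - quantile K.snd u)) (φ zε)) ∂unif :=
        lintegral_mono fun u => ENNReal.ofReal_le_ofReal (le_max_left _ _)
    _ ≤ ∫⁻ p, ENNReal.ofReal (max (φ (p.1 - p.2)) (φ zε)) ∂K := h K
    _ ≤ ∫⁻ p, (ENNReal.ofReal (φ (p.1 - p.2)) + ε) ∂K := by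
        refine lintegral_mono fun p => ?_
        rw [← ENNReal.ofReal_coe_nnreal, ← ENNReal.ofReal_add (h0 _) (NNReal.coe_nonneg ε)]
        refine ENNReal.ofReal_le_ofReal (max_le (by simp) ?_)
        exact hz.le.trans (by gcongr; exact ciInf_le hb _)
    _ = ∫⁻ p, ENNReal.ofReal (φ (p.1 - p.2)) ∂K + ε := by
        rw [lintegral_add_right _ measurable_const]
        simp

/-- The Lipschitz regularisation (Pasch–Hausdorff envelope) of a function on the line. -/
noncomputable def lipEnvelope (f : ℝ → ℝ≥0∞) (n : ℕ) (z : ℝ) : ℝ≥0∞ := ⨅ w, f w + n * edist z w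

theorem lipEnvelope_mono (f : ℝ → ℝ≥0∞) : Monotone (lipEnvelope f) := by
  intro m n h z
  refine iInf_mono fun w => ?_
  gcongr

/-- For b < f z, competitors near z have f > b by semicontinuity, and those at distance at least δ
pay n δ ≥ b once n is large. -/
theorem iSup_lipEnvelope {f : ℝ → ℝ≥0∞} (hf : LowerSemicontinuous f) (z : ℝ) :
    ⨆ n, lipEnvelope f n z = f z := by
  refine le_antisymm (iSup_le fun n => (iInf_le _ z).trans (by simp)) ?_
  refine le_of_forall_lt fun a ha => ?_
  obtain ⟨b, hab, hb⟩ := exists_between ha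
  obtain ⟨δ, hδ, hball⟩ := EMetric.mem_nhds_iff.1 (hf z b hb)
  have hbt : b ≠ ⊤ := (hb.trans_le le_top).ne
  obtain ⟨n, hn⟩ := ENNReal.exists_nat_gt (ENNReal.div_ne_top hbt hδ.ne')
  refine hab.trans_le (le_iSup_of_le n (le_iInf fun w => ?_))
  by_cases hw : edist w z < δ
  · exact (hball hw).le.trans le_self_add
  · refine le_add_left ?_
    rw [edist_comm]
    calc b ≤ n * δ := by
            by_cases hδt : δ = ⊤
            · rw [hδt, ENNReal.mul_top (fun h => by simp [h] at hn)]
              exact le_top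
            · exact (ENNReal.div_le_iff hδ.ne' hδt).1 hn.le
      _ ≤ n * edist w z := by gcongr; exact not_lt.1 hw

theorem lipEnvelope_convex {f : ℝ → ℝ≥0∞}
    (hf : ∀ (x y : ℝ) (a b : ℝ≥0), a + b = 1 → f (a * x + b * y) ≤ a * f x + b * f y) (n : ℕ)
    (x y : ℝ) (a b : ℝ≥0) (hab : a + b = 1) :
    lipEnvelope f n (a * x + b * y) ≤ a * lipEnvelope f n x + b * lipEnvelope f n y := by
  -- A nonzero finite weight is needed to move it inside the infimum.
  rcases eq_or_ne a 0 with rfl | ha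
  · simp [show b = 1 by simpa using hab]
  rcases eq_or_ne b 0 with rfl | hb
  · simp [show a = 1 by simpa using hab]
  unfold lipEnvelope
  rw [ENNReal.mul_iInf_of_ne (by simpa using ha) (by simp),
    ENNReal.mul_iInf_of_ne (by simpa using hb) (by simp), ENNReal.iInf_add]
  refine le_iInf fun w₁ => ?_
  rw [ENNReal.add_iInf]
  refine le_iInf fun w₂ => (iInf_le _ (a * w₁ + b * w₂)).trans ?_
  have h1 : edist (a * x + b * y) (a * w₁ + b * w₂) ≤ a * edist x w₁ + b * edist y w₂ := by
    refine (edist_add_add_le _ _ _ _).trans (le_of_eq ?_)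
    simp only [edist_eq_enorm_sub, ← mul_sub, enorm_mul]
    simp
  calc f (a * w₁ + b * w₂) + n * edist (a * x + b * y) (a * w₁ + b * w₂)
      ≤ (a * f w₁ + b * f w₂) + n * (a * edist x w₁ + b * edist y w₂) := by
        gcongr
        exact hf _ _ _ _ hab
    _ = _ := by ring

/-- Optimality of the comonotone coupling on the line for costs that are lower semicontinuous
convex functions of the difference, possibly with infinite values. -/
theorem comonotoneOptimal_of_convex_lsc {f : ℝ → ℝ≥0∞} (hlsc : LowerSemicontinuous f)
    (hf : ∀ (x y : ℝ) (a b : ℝ≥0), a + b = 1 → f (a * x + b * y) ≤ a * f x + b * f y) :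
    ComonotoneOptimal f := by
  by_cases htop : ∀ w, f w = ⊤
  · intro K _
    simp [htop]
  push Not at htop
  obtain ⟨w, hw⟩ := htop
  -- One finite value of f makes every envelope finite everywhere; the real-valued convex case
  -- applies to each, and monotone convergence gives f.
  have hfin : ∀ n z, lipEnvelope f n z ≠ ⊤ := fun n z =>
    ((iInf_le _ w).trans_lt (by
      refine ENNReal.add_lt_top.2 ⟨hw.lt_top, ENNReal.mul_lt_top (by simp) ?_⟩
      exact edist_lt_top _ _)).ne
  have hconv : ∀ n, ConvexOn ℝ univ fun z => (lipEnvelope f n z).toReal := by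
    intro n
    refine ⟨convex_univ, fun x _ y _ a b ha hb hab => ?_⟩
    lift a to ℝ≥0 using ha
    lift b to ℝ≥0 using hb
    have h := lipEnvelope_convex hf n x y a b (by exact_mod_cast hab)
    have ht : ∀ (c : ℝ≥0) z, (c : ℝ≥0∞) * lipEnvelope f n z ≠ ⊤ := fun c z =>
      ENNReal.mul_ne_top (by simp) (hfin n z)
    have := ENNReal.toReal_mono (ENNReal.add_ne_top.2 ⟨ht _ _, ht _ _⟩) h
    rw [ENNReal.toReal_add (ht _ _) (ht _ _), ENNReal.toReal_mul, ENNReal.toReal_mul] at this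
    simpa using this
  have hE : ∀ n z, ENNReal.ofReal (lipEnvelope f n z).toReal = lipEnvelope f n z := fun n z =>
    ENNReal.ofReal_toReal (hfin n z)
  have hmeas : ∀ n, Measurable (lipEnvelope f n) := by
    intro n
    have hc : Continuous fun z => (lipEnvelope f n z).toReal := by
      rw [← continuousOn_univ]
      exact (hconv n).continuousOn isOpen_univ
    simpa only [hE] using hc.measurable.ennreal_ofReal
  intro K _
  have hq : Measurable fun u => quantile K.fst u - quantile K.snd u :=
    (measurable_quantile K.fst).sub (measurable_quantile K.snd)
  simp_rw [← iSup_lipEnvelope hlsc]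
  rw [lintegral_iSup (f := fun n u => lipEnvelope f n (quantile K.fst u - quantile K.snd u))
    (fun n => (hmeas n).comp hq) (fun m n h u => lipEnvelope_mono f h _)]
  refine iSup_le fun n => ?_
  have h := comonotoneOptimal_convex_real (hconv n) (fun z => ENNReal.toReal_nonneg) K
  simp_rw [hE] at h
  exact h.trans (lintegral_mono fun p => le_iSup (fun n => lipEnvelope f n (p.1 - p.2)) n)

end

/-! ### Path measures through successive conditional laws, and a criterion for causality. -/

section

variable {N : ℕ}

/-- The coordinates of a path strictly before time `r`. -/
def past (r : Fin N) (x : Path N) : Iio r → ℝ := fun i => x i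

@[fun_prop]
theorem measurable_past (r : Fin N) : Measurable (past r) :=
  measurable_pi_lambda _ fun i => measurable_pi_apply i.1

/-- From time `k` on, `κ` gives the conditional laws of the next coordinate given the past. -/
def CompatFrom (κ : ∀ r : Fin N, Kernel (Iio r → ℝ) ℝ) (k : ℕ) (m : Measure (Path N)) : Prop :=
  ∀ r : Fin N, k ≤ r.val → ∀ F : (Iio r → ℝ) × ℝ → ℝ≥0∞, Measurable F →
    ∫⁻ x, F (past r x, x r) ∂m = ∫⁻ x, ∫⁻ z, F (past r x, z) ∂(κ r (past r x)) ∂m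

theorem CompatFrom.mono {κ : ∀ r : Fin N, Kernel (Iio r → ℝ) ℝ} {k l : ℕ} (hkl : k ≤ l)
    {m : Measure (Path N)} (h : CompatFrom κ k m) : CompatFrom κ l m :=
  fun r hr => h r (hkl.trans hr)

/-- The first `k` coordinates of a path. -/
def head (k : ℕ) (x : Path N) : {i : Fin N // i.val < k} → ℝ := fun i => x i

@[fun_prop]
theorem measurable_head (k : ℕ) : Measurable (head (N := N) k) :=
  measurable_pi_lambda _ fun i => measurable_pi_apply i.1

/-- Induction step for uniqueness: the law of one more coordinate is the previous law composed with
κ r. -/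
theorem map_head_succ_eq {κ : ∀ r : Fin N, Kernel (Iio r → ℝ) ℝ} [∀ r, IsMarkovKernel (κ r)]
    {k : ℕ} {m m' : Measure (Path N)} (h : CompatFrom κ k m) (h' : CompatFrom κ k m')
    (r : Fin N) (hk : k ≤ r.val) (heq : m.map (head r.val) = m'.map (head r.val)) :
    m.map (head (r.val + 1)) = m'.map (head (r.val + 1)) := by
  let glue : (Iio r → ℝ) × ℝ → {i : Fin N // i.val < r.val + 1} → ℝ :=
    fun p i => if hi : i.1 < r then p.1 ⟨i.1, hi⟩ else p.2
  have hglue : Measurable glue := by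
    refine measurable_pi_lambda _ fun i => ?_
    by_cases hi : i.1 < r
    · simp only [glue, hi, dif_pos]; fun_prop
    · simp only [glue, hi, dif_neg, not_false_iff]; fun_prop
  have hhead : ∀ x : Path N, head (r.val + 1) x = glue (past r x, x r) := by
    intro x
    ext i
    by_cases hi : i.1 < r
    · simp [glue, hi, head, past]
    · have : i.1 = r := le_antisymm (Fin.le_def.2 (Nat.lt_succ_iff.1 i.2)) (not_lt.1 hi)
      simp [glue, head, this]
  let conv : ({i : Fin N // i.val < r.val} → ℝ) → Iio r → ℝ := fun z i => z ⟨i.1, i.2⟩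
  have hconv : Measurable conv := by
    refine measurable_pi_lambda _ fun i => measurable_pi_apply _
  refine Measure.ext_of_lintegral _ fun F hF => ?_
  rw [lintegral_map hF (by fun_prop), lintegral_map hF (by fun_prop)]
  simp_rw [hhead]
  rw [h r hk (fun p => F (glue p)) (hF.comp hglue), h' r hk (fun p => F (glue p)) (hF.comp hglue)]
  have hG : Measurable fun a => ∫⁻ z, F (glue (a, z)) ∂(κ r a) :=
    (hF.comp hglue).lintegral_kernel_prod_right'
  have h1 := lintegral_map (μ := m) (hG.comp hconv) (measurable_head r.val)
  have h2 := lintegral_map (μ := m') (hG.comp hconv) (measurable_head r.val)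
  rw [heq] at h1
  exact h1.symm.trans h2

/-- A measure is determined by the law of the first `k` coordinates and the later conditional
laws. -/
theorem eq_of_compatFrom {κ : ∀ r : Fin N, Kernel (Iio r → ℝ) ℝ} [∀ r, IsMarkovKernel (κ r)]
    {k : ℕ} (hkN : k ≤ N) {m m' : Measure (Path N)} (h : CompatFrom κ k m)
    (h' : CompatFrom κ k m') (heq : m.map (head k) = m'.map (head k)) : m = m' := by
  have key : ∀ n, k ≤ n → n ≤ N → m.map (head n) = m'.map (head n) := by
    intro n hn
    induction n, hn using Nat.le_induction with
    | base => exact fun _ => heq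
    | succ n hn ih => exact fun hN => map_head_succ_eq h h' ⟨n, hN⟩ hn (ih (by omega))
  have hN := key N hkN le_rfl
  let ext : ({i : Fin N // i.val < N} → ℝ) → Path N := fun z i => z ⟨i, i.2⟩
  have hext : Measurable ext := measurable_pi_lambda _ fun i => measurable_pi_apply _
  have hid : ∀ m : Measure (Path N), (m.map (head N)).map ext = m := by
    intro m
    rw [Measure.map_map hext (measurable_head N)]
    exact Measure.map_id
  rw [← hid m, hN, hid]

theorem eq_of_compatFrom_zero {κ : ∀ r : Fin N, Kernel (Iio r → ℝ) ℝ} [∀ r, IsMarkovKernel (κ r)]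
    {m m' : Measure (Path N)} [IsProbabilityMeasure m] [IsProbabilityMeasure m']
    (h : CompatFrom κ 0 m) (h' : CompatFrom κ 0 m') : m = m' := by
  refine eq_of_compatFrom (Nat.zero_le N) h h' ?_
  have : IsEmpty {i : Fin N // i.val < 0} := ⟨fun i => Nat.not_lt_zero _ i.2⟩
  refine Measure.ext fun s hs => ?_
  rw [Measure.map_apply (measurable_head 0) hs, Measure.map_apply (measurable_head 0) hs]
  rcases Subsingleton.eq_empty_or_singleton (s := s) (fun a _ b _ => Subsingleton.elim a b)
    with rfl | ⟨a, rfl⟩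
  · simp
  · have : head 0 ⁻¹' {a} = (univ : Set (Path N)) := by
      ext x
      simp [Subsingleton.elim (head 0 x) a]
    rw [this, measure_univ, measure_univ]

/-- A density in the first k coordinates is constant for the conditional integrals at times r ≥ k
and factors out. -/
theorem CompatFrom.withDensity {κ : ∀ r : Fin N, Kernel (Iio r → ℝ) ℝ}
    [∀ r, IsMarkovKernel (κ r)] {k : ℕ} {m : Measure (Path N)} (h : CompatFrom κ k m)
    {g : ({i : Fin N // i.val < k} → ℝ) → ℝ≥0∞} (hg : Measurable g) :
    CompatFrom κ k (m.withDensity fun x => g (head k x)) := by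
  intro r hr F hF
  let conv : (Iio r → ℝ) → {i : Fin N // i.val < k} → ℝ :=
    fun z i => z ⟨i.1, Fin.lt_def.2 (i.2.trans_le hr)⟩
  have hconv : Measurable conv := measurable_pi_lambda _ fun i => measurable_pi_apply _
  have hG : Measurable fun x : Path N => ∫⁻ z, F (past r x, z) ∂(κ r (past r x)) :=
    (hF.lintegral_kernel_prod_right' (κ := κ r)).comp (measurable_past r)
  have hgm : Measurable fun x : Path N => g (head k x) := hg.comp (measurable_head k)
  rw [lintegral_withDensity_eq_lintegral_mul _ hgm (by fun_prop),
    lintegral_withDensity_eq_lintegral_mul _ hgm hG]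
  have := h r hr (fun p => g (conv p.1) * F p) (by fun_prop)
  refine this.trans (lintegral_congr fun x => ?_)
  exact lintegral_const_mul (g (head k x)) (f := fun z => F (past r x, z)) (by fun_prop)

/-- Given the past of both paths, the next coordinate of the first path has a conditional law that
depends on the past of the first path only, and is given by `κ`. -/
def FirstMarkov (κ : ∀ r : Fin N, Kernel (Iio r → ℝ) ℝ) (γ : Measure (Path N × Path N)) : Prop :=
  ∀ (r : Fin N) (F : ((Iio r → ℝ) × (Iio r → ℝ)) × ℝ → ℝ≥0∞), Measurable F →
    ∫⁻ p, F ((past r p.1, past r p.2), p.1 r) ∂γ =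
      ∫⁻ p, ∫⁻ z, F ((past r p.1, past r p.2), z) ∂(κ r (past r p.1)) ∂γ

theorem FirstMarkov.compatFrom_weighted {κ : ∀ r : Fin N, Kernel (Iio r → ℝ) ℝ}
    [∀ r, IsMarkovKernel (κ r)] {γ : Measure (Path N × Path N)} (h : FirstMarkov κ γ) {k : ℕ}
    {g : Path N → ℝ≥0∞} (hgm : Measurable g)
    (hg : ∀ r : Fin N, k ≤ r.val →
      ∃ g' : (Iio r → ℝ) → ℝ≥0∞, Measurable g' ∧ ∀ y, g y = g' (past r y)) :
    CompatFrom κ k (γ.withDensity fun p => g p.2).fst := by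
  intro r hr F hF
  obtain ⟨g', hg', hgg'⟩ := hg r hr
  have hG : Measurable fun x : Path N => ∫⁻ z, F (past r x, z) ∂(κ r (past r x)) :=
    (hF.lintegral_kernel_prod_right' (κ := κ r)).comp (measurable_past r)
  have hG2 : Measurable fun p : Path N × Path N =>
      ∫⁻ z, F (past r p.1, z) ∂(κ r (past r p.1)) := hG.comp measurable_fst
  have hg2 : Measurable fun p : Path N × Path N => g p.2 := hgm.comp measurable_snd
  rw [Measure.fst, lintegral_map (by fun_prop) measurable_fst,
    lintegral_map hG measurable_fst,
    lintegral_withDensity_eq_lintegral_mul _ hg2 (by fun_prop),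
    lintegral_withDensity_eq_lintegral_mul _ hg2 hG2]
  have := h r (fun p => g' p.1.2 * F (p.1.1, p.2)) (by fun_prop)
  simp only [Pi.mul_apply, hgg']
  refine this.trans (lintegral_congr fun x => ?_)
  exact lintegral_const_mul (g' (past r x.2)) (f := fun z => F (past r x.1, z)) (by fun_prop)

theorem FirstMarkov.compatFrom_fst {κ : ∀ r : Fin N, Kernel (Iio r → ℝ) ℝ}
    [∀ r, IsMarkovKernel (κ r)] {γ : Measure (Path N × Path N)} (h : FirstMarkov κ γ) :
    CompatFrom κ 0 γ.fst := by
  have := h.compatFrom_weighted (k := 0) (g := fun _ => 1) measurable_const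
    (fun r _ => ⟨fun _ => 1, measurable_const, fun _ => rfl⟩)
  simpa [withDensity_one] using this

/-- Weighting by the indicator of B preserves the conditional laws of x after time t. By uniqueness
the weighted marginal is then the marginal times a density computed on the coordinates up to t
alone. -/
theorem isCausal_of_firstMarkov {κ : ∀ r : Fin N, Kernel (Iio r → ℝ) ℝ}
    [∀ r, IsMarkovKernel (κ r)] {γ : Measure (Path N × Path N)} [IsProbabilityMeasure γ]
    (h : FirstMarkov κ γ) : IsCausal γ := by
  intro t B hB
  have hBm : MeasurableSet B := (Filtration.piLE (X := fun _ : Fin N => ℝ)).le t B hB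
  obtain ⟨E, hE, hBE⟩ := hB
  set m : Measure (Path N) := (γ.withDensity fun p => B.indicator 1 p.2).fst with hm
  have hind : Measurable (B.indicator (1 : Path N → ℝ≥0∞)) := measurable_one.indicator hBm
  have hmA : ∀ A, MeasurableSet A → m A = γ (A ×ˢ B) := by
    intro A hA
    rw [hm, Measure.fst_apply hA, withDensity_apply _ (hA.preimage measurable_fst)]
    have : (fun p : Path N × Path N => B.indicator (1 : Path N → ℝ≥0∞) p.2) =
        (Prod.snd ⁻¹' B).indicator 1 := rfl
    rw [this, lintegral_indicator_one (hBm.preimage measurable_snd),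
      Measure.restrict_apply (hBm.preimage measurable_snd), inter_comm]
    rfl
  -- B may involve y_t, so its indicator is a function of the past only from time t + 1 on.
  have hcompat : CompatFrom κ (t.val + 1) m := by
    refine h.compatFrom_weighted hind fun r hr => ?_
    let conv : (Iio r → ℝ) → Iic t → ℝ := fun z i => z ⟨i.1, mem_Iio.2 (lt_of_le_of_lt (mem_Iic.1 i.2) (Fin.lt_def.2 hr))⟩
    have hconv : Measurable conv := measurable_pi_lambda _ fun i => measurable_pi_apply _
    exact ⟨(conv ⁻¹' E).indicator 1, measurable_one.indicator (hE.preimage hconv), fun y => by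
      rw [← hBE]; rfl⟩
  have hle : m ≤ γ.fst := by
    refine Measure.le_iff.2 fun A hA => ?_
    rw [hmA A hA, Measure.fst_apply hA]
    exact measure_mono fun p hp => hp.1
  have : IsFiniteMeasure m := isFiniteMeasure_of_le _ hle
  set g := (m.map (head (t.val + 1))).rnDeriv (γ.fst.map (head (t.val + 1)))
  have hgm : Measurable g := Measure.measurable_rnDeriv _ _
  have hdens : (γ.fst.map (head (t.val + 1))).withDensity g = m.map (head (t.val + 1)) :=
    Measure.withDensity_rnDeriv_eq _ _
      (Measure.absolutelyContinuous_of_le (Measure.map_mono hle (measurable_head _)))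
  have hmeq : m = γ.fst.withDensity fun x => g (head (t.val + 1) x) := by
    refine eq_of_compatFrom (Nat.succ_le_of_lt t.2) hcompat
      ((h.compatFrom_fst.mono (Nat.zero_le _)).withDensity hgm) ?_
    rw [← hdens]
    refine Measure.ext fun s hs => ?_
    rw [withDensity_apply _ hs, setLIntegral_map hs hgm (measurable_head _),
      Measure.map_apply (measurable_head _) hs,
      withDensity_apply _ (hs.preimage (measurable_head _))]
  refine ⟨fun x => g (head (t.val + 1) x), ?_, ?_⟩
  · let conv : (Iic t → ℝ) → {i : Fin N // i.val < t.val + 1} → ℝ :=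
      fun z i => z ⟨i.1, Fin.le_def.2 (Nat.lt_succ_iff.1 i.2)⟩
    have hconv : Measurable conv := measurable_pi_lambda _ fun i => measurable_pi_apply _
    exact (hgm.comp hconv).comp (comap_measurable _)
  · refine ae_eq_of_forall_setLIntegral_eq_of_sigmaFinite
      (Kernel.measurable_coe _ hBm) (hgm.comp (measurable_head _)) fun A hA _ => ?_
    rw [Measure.setLIntegral_condKernel_eq_measure_prod hA hBm, ← hmA A hA, hmeq,
      withDensity_apply _ hA]

end

/-! ### The Knothe–Rosenblatt rearrangement: marginals, causality, Monge map. -/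

section

variable {N : ℕ}

theorem compatFrom_pi (m : Fin N → Measure ℝ) [∀ i, IsProbabilityMeasure (m i)] :
    CompatFrom (fun r => Kernel.const _ (m r)) 0 (Measure.pi m) := by
  intro r _ F hF
  simp only [Kernel.const_apply]
  let A : Measure (Iio r → ℝ) := Measure.pi fun i : {i // i ∈ Iio r} => m i
  let B := Measure.pi fun i : {i // i ∉ Iio r} => m i
  have he : MeasurePreserving
      (fun u : Path N => (past r u, fun i : {i // i ∉ Iio r} => u i)) (Measure.pi m) (A.prod B) := by
    convert! measurePreserving_piEquivPiSubtypeProd m (fun i => i ∈ Iio r)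
  have hB : B.map (fun z => z ⟨r, by simp⟩) = m r :=
    (measurePreserving_eval (fun i : {i // i ∉ Iio r} => m i) ⟨r, by simp⟩).map_eq
  have hG : Measurable fun a => ∫⁻ v, F (a, v) ∂(m r) := hF.lintegral_prod_right'
  have hG' : Measurable fun p : (Iio r → ℝ) × ({i // i ∉ Iio r} → ℝ) =>
      ∫⁻ v, F (p.1, v) ∂(m r) := hG.comp measurable_fst
  have h1 : ∫⁻ u, F (past r u, u r) ∂(Measure.pi m) =
      ∫⁻ p, F (p.1, p.2 ⟨r, by simp⟩) ∂(A.prod B) := by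
    rw [← he.map_eq, lintegral_map (by fun_prop) he.measurable]
  have h2 : ∫⁻ u, ∫⁻ v, F (past r u, v) ∂(m r) ∂(Measure.pi m) =
      ∫⁻ p, ∫⁻ v, F (p.1, v) ∂(m r) ∂(A.prod B) := by
    rw [← he.map_eq, lintegral_map hG' he.measurable]
  have : IsProbabilityMeasure B := by unfold B; infer_instance
  have : SFinite A := by unfold A; infer_instance
  rw [h1, h2, lintegral_prod _ (by fun_prop), lintegral_prod _ hG'.aemeasurable]
  refine lintegral_congr fun a => ?_
  dsimp only
  rw [lintegral_const, measure_univ, mul_one, ← hB, lintegral_map (by fun_prop) (by fun_prop)]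

instance (η : Measure (Path N)) [IsFiniteMeasure η] (t : Fin N) : IsMarkovKernel (condLaw η t) := by
  unfold condLaw
  infer_instance

theorem compatFrom_condLaw (η : Measure (Path N)) [IsFiniteMeasure η] :
    CompatFrom (condLaw η) 0 η := by
  intro r _ F hF
  have h : η.map (past r) ⊗ₘ condLaw η r = η.map fun x => (past r x, x r) :=
    compProd_map_condDistrib (X := past r) (measurable_pi_apply r).aemeasurable
  have hG : Measurable fun a => ∫⁻ z, F (a, z) ∂(condLaw η r a) :=
    hF.lintegral_kernel_prod_right'
  rw [← lintegral_map (f := F) hF (by fun_prop), ← h, Measure.lintegral_compProd hF,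
    lintegral_map hG (measurable_past r)]

theorem quantileTransform_eq (η : Measure (Path N)) [IsFiniteMeasure η] (u : Path N) (t : Fin N) :
    quantileTransform η u t =
      quantile (condLaw η t (past t (quantileTransform η u))) (u t) := by
  rw [quantileTransform]
  rfl

theorem measurable_quantileTransform (η : Measure (Path N)) [IsFiniteMeasure η] :
    Measurable (quantileTransform η) := by
  refine measurable_pi_lambda _ fun t => ?_
  induction t using WellFoundedLT.induction with
  | ind t ih =>
    simp_rw [quantileTransform_eq η _ t]
    have hp : Measurable fun u => past t (quantileTransform η u) :=
      measurable_pi_lambda _ fun i => ih i.1 i.2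
    exact (measurable_quantile_kernel (condLaw η t)).comp (hp.prodMk (measurable_pi_apply t))

theorem quantileTransform_congr (η : Measure (Path N)) [IsFiniteMeasure η] {u u' : Path N}
    (t : Fin N) (h : ∀ i ≤ t, u i = u' i) : quantileTransform η u t = quantileTransform η u' t := by
  induction t using WellFoundedLT.induction with
  | ind t ih =>
    rw [quantileTransform_eq, quantileTransform_eq η u', h t le_rfl]
    congr 2
    ext i
    exact ih i.1 i.2 fun j hj => h j (hj.trans (le_of_lt i.2))

/-- Extension of the coordinates before time `r` to a path, by `0`. -/
def extendPast (r : Fin N) (z : Iio r → ℝ) : Path N := fun i => if h : i < r then z ⟨i, h⟩ else 0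

@[fun_prop]
theorem measurable_extendPast (r : Fin N) : Measurable (extendPast r) := by
  refine measurable_pi_lambda _ fun i => ?_
  by_cases h : i < r
  · simp only [extendPast, h, dif_pos]; fun_prop
  · simp only [extendPast, h, dif_neg, not_false_iff]; fun_prop

theorem extendPast_past {r i : Fin N} (h : i < r) (x : Path N) :
    extendPast r (past r x) i = x i := by
  simp [extendPast, past, h]

/-- Exhibits the past of the transform as a function of the past of u, the form in which
independence of u_r can be used. The padding by 0 is never read. -/
theorem past_quantileTransform (η : Measure (Path N)) [IsFiniteMeasure η] (r : Fin N)
    (u : Path N) : past r (quantileTransform η u) =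
      past r (quantileTransform η (extendPast r (past r u))) := by
  ext i
  exact quantileTransform_congr η i.1 fun j hj =>
    (extendPast_past (lt_of_le_of_lt hj i.2) u).symm

instance (N : ℕ) : IsProbabilityMeasure (uniformCube N) :=
  inferInstanceAs (IsProbabilityMeasure (Measure.pi fun _ => unif))

theorem compatFrom_uniformCube :
    CompatFrom (fun _ => Kernel.const _ unif) 0 (uniformCube N) :=
  compatFrom_pi fun _ : Fin N => unif

theorem measurable_quantileTransform_prod (μ ν : Measure (Path N)) [IsFiniteMeasure μ]
    [IsFiniteMeasure ν] :
    Measurable fun u => (quantileTransform μ u, quantileTransform ν u) :=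
  (measurable_quantileTransform μ).prodMk (measurable_quantileTransform ν)

instance (μ ν : Measure (Path N)) [IsFiniteMeasure μ] [IsFiniteMeasure ν] :
    IsProbabilityMeasure (knotheRosenblatt μ ν) :=
  Measure.isProbabilityMeasure_map (measurable_quantileTransform_prod μ ν).aemeasurable

theorem lintegral_quantile_unif (η : Measure ℝ) [IsProbabilityMeasure η] {F : ℝ → ℝ≥0∞}
    (hF : Measurable F) : ∫⁻ v, F (quantile η v) ∂unif = ∫⁻ z, F z ∂η := by
  have h := lintegral_map (μ := unif) hF (measurable_quantile η)
  rw [map_quantile_unif] at h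
  exact h.symm

/-- Both pasts are functions of u_{<r}, while u_r is independent uniform noise, whose quantile
transform has the prescribed conditional law. -/
theorem firstMarkov_knotheRosenblatt (μ ν : Measure (Path N)) [IsFiniteMeasure μ]
    [IsFiniteMeasure ν] : FirstMarkov (condLaw μ) (knotheRosenblatt μ ν) := by
  intro r F hF
  have hX := measurable_quantileTransform μ
  have hY := measurable_quantileTransform ν
  have hq := measurable_quantile_kernel (condLaw μ r)
  have hG : Measurable fun p : Path N × Path N =>
      ∫⁻ z, F ((past r p.1, past r p.2), z) ∂(condLaw μ r (past r p.1)) := by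
    have : Measurable fun a : (Iio r → ℝ) × (Iio r → ℝ) =>
        ∫⁻ z, F (a, z) ∂((condLaw μ r).prodMkRight (Iio r → ℝ) a) :=
      hF.lintegral_kernel_prod_right'
    exact this.comp (f := fun p : Path N × Path N => (past r p.1, past r p.2)) (by fun_prop)
  rw [knotheRosenblatt, lintegral_map (by fun_prop) (measurable_quantileTransform_prod μ ν),
    lintegral_map hG (measurable_quantileTransform_prod μ ν)]
  have hmeas : Measurable fun p : (Iio r → ℝ) × ℝ =>
      F ((past r (quantileTransform μ (extendPast r p.1)),
        past r (quantileTransform ν (extendPast r p.1))),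
        quantile (condLaw μ r (past r (quantileTransform μ (extendPast r p.1)))) p.2) := by
    have h1 : Measurable fun p : (Iio r → ℝ) × ℝ =>
        (past r (quantileTransform μ (extendPast r p.1)), p.2) := by fun_prop
    have h2 := hq.comp h1
    simp only [Function.comp_def] at h2
    fun_prop
  refine (lintegral_congr fun u => ?_).trans
    ((compatFrom_uniformCube r (Nat.zero_le _) _ hmeas).trans (lintegral_congr fun u => ?_))
  · dsimp only
    rw [quantileTransform_eq μ _ r, past_quantileTransform μ r u, past_quantileTransform ν r u]
  · dsimp only
    rw [past_quantileTransform μ r u, past_quantileTransform ν r u]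
    exact lintegral_quantile_unif _ (hF.comp measurable_prodMk_left)

theorem map_swap_knotheRosenblatt (μ ν : Measure (Path N)) [IsFiniteMeasure μ]
    [IsFiniteMeasure ν] : (knotheRosenblatt μ ν).map Prod.swap = knotheRosenblatt ν μ := by
  rw [knotheRosenblatt, Measure.map_map measurable_swap (measurable_quantileTransform_prod μ ν)]
  rfl

theorem fst_knotheRosenblatt (μ ν : Measure (Path N)) [IsProbabilityMeasure μ]
    [IsProbabilityMeasure ν] : (knotheRosenblatt μ ν).fst = μ :=
  eq_of_compatFrom_zero (firstMarkov_knotheRosenblatt μ ν).compatFrom_fst (compatFrom_condLaw μ)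

theorem snd_knotheRosenblatt (μ ν : Measure (Path N)) [IsProbabilityMeasure μ]
    [IsProbabilityMeasure ν] : (knotheRosenblatt μ ν).snd = ν := by
  rw [← Measure.fst_map_swap, map_swap_knotheRosenblatt, fst_knotheRosenblatt]

theorem map_quantileTransform (μ : Measure (Path N)) [IsProbabilityMeasure μ] :
    (uniformCube N).map (quantileTransform μ) = μ := by
  have h := fst_knotheRosenblatt μ μ
  rwa [knotheRosenblatt, Measure.fst_map_prodMk (measurable_quantileTransform μ)] at h

theorem knotheRosenblatt_mem_causalPlans (μ ν : Measure (Path N)) [IsProbabilityMeasure μ]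
    [IsProbabilityMeasure ν] : knotheRosenblatt μ ν ∈ causalPlans μ ν :=
  ⟨inferInstance, fst_knotheRosenblatt μ ν, snd_knotheRosenblatt μ ν,
    isCausal_of_firstMarkov (firstMarkov_knotheRosenblatt μ ν)⟩

instance (μ : Measure (Path N)) [IsProbabilityMeasure μ] (t : Fin N) :
    IsProbabilityMeasure (μ.map fun x => x t) :=
  Measure.isProbabilityMeasure_map (measurable_pi_apply t).aemeasurable

/-- Under a product law, the conditional laws are the marginals. -/
theorem condLaw_ae_eq_of_pi {μ : Measure (Path N)} [IsProbabilityMeasure μ]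
    (hμ : μ = Measure.pi fun t => μ.map fun x => x t) (r : Fin N) :
    ∀ᵐ x ∂μ, condLaw μ r (past r x) = μ.map fun x => x r := by
  have h : condLaw μ r =ᵐ[μ.map (past r)] Kernel.const _ (μ.map fun x => x r) := by
    refine condDistrib_ae_eq_of_measure_eq_compProd (X := past r) (measurable_pi_apply r).aemeasurable ?_
    refine Measure.ext_of_lintegral _ fun F hF => ?_
    have hc := compatFrom_pi (fun t => μ.map fun x => x t)
    rw [← hμ] at hc
    rw [lintegral_map hF (by fun_prop), hc r (Nat.zero_le _) F hF, Measure.lintegral_compProd hF,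
      lintegral_map hF.lintegral_kernel_prod_right' (measurable_past r)]
  exact ae_of_ae_map (measurable_past r).aemeasurable h

theorem knotheRosenblattMap_eq (μ ν : Measure (Path N)) [IsFiniteMeasure μ] [IsFiniteMeasure ν]
    (x : Path N) (t : Fin N) : knotheRosenblattMap μ ν x t =
      quantile (condLaw ν t (past t (knotheRosenblattMap μ ν x)))
        (cdf (condLaw μ t (past t x)) (x t)) := by
  rw [knotheRosenblattMap]
  rfl

theorem measurable_knotheRosenblattMap (μ ν : Measure (Path N)) [IsFiniteMeasure μ]
    [IsFiniteMeasure ν] : Measurable (knotheRosenblattMap μ ν) := by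
  refine measurable_pi_lambda _ fun t => ?_
  induction t using WellFoundedLT.induction with
  | ind t ih =>
    simp_rw [knotheRosenblattMap_eq μ ν _ t]
    have hp : Measurable fun x => past t (knotheRosenblattMap μ ν x) :=
      measurable_pi_lambda _ fun i => ih i.1 i.2
    exact (measurable_quantile_kernel (condLaw ν t)).comp (hp.prodMk
      ((measurable_cdf_kernel (condLaw μ t)).comp
        ((measurable_past t).prodMk (measurable_pi_apply t))))

theorem ae_uniformCube_mem_Ioo : ∀ᵐ u ∂uniformCube N, ∀ t, u t ∈ Ioo (0 : ℝ) 1 := by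
  refine ae_all_iff.2 fun t => ?_
  have h : MeasurePreserving (Function.eval t) (uniformCube N) unif :=
    measurePreserving_eval (fun _ : Fin N => unif) t
  exact h.quasiMeasurePreserving.ae ae_unif_mem_Ioo

theorem ae_condLaw_quantileTransform_of_pi {μ : Measure (Path N)} [IsProbabilityMeasure μ]
    (hμ : μ = Measure.pi fun t => μ.map fun x => x t) :
    ∀ᵐ u ∂uniformCube N, ∀ t,
      condLaw μ t (past t (quantileTransform μ u)) = μ.map fun x => x t := by
  refine ae_all_iff.2 fun t => ?_
  have h : MeasurePreserving (quantileTransform μ) (uniformCube N) μ :=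
    ⟨measurable_quantileTransform μ, map_quantileTransform μ⟩
  exact h.quasiMeasurePreserving.ae (condLaw_ae_eq_of_pi hμ t)

/-- The product structure turns conditional laws of μ into its atomless marginals, so applying
F_{μ_t} recovers u_t; the earlier coordinates agree by induction. -/
theorem ae_knotheRosenblattMap_quantileTransform {μ : Measure (Path N)} (ν : Measure (Path N))
    [IsProbabilityMeasure μ] [IsProbabilityMeasure ν]
    (hμ : μ = Measure.pi fun t => μ.map fun x => x t)
    (hatom : ∀ (t : Fin N) (a : ℝ), (μ.map fun x => x t) {a} = 0) :
    ∀ᵐ u ∂uniformCube N,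
      knotheRosenblattMap μ ν (quantileTransform μ u) = quantileTransform ν u := by
  filter_upwards [ae_uniformCube_mem_Ioo, ae_condLaw_quantileTransform_of_pi hμ] with u hu hc
  ext t
  induction t using WellFoundedLT.induction with
  | ind t ih =>
    have hp : past t (knotheRosenblattMap μ ν (quantileTransform μ u)) =
        past t (quantileTransform ν u) := by
      ext i
      exact ih i.1 i.2
    rw [knotheRosenblattMap_eq, hp, quantileTransform_eq ν, hc t, quantileTransform_eq μ, hc t,
      cdf_quantile _ (hatom t) (hu t)]

theorem knotheRosenblatt_eq_map {μ : Measure (Path N)} (ν : Measure (Path N))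
    [IsProbabilityMeasure μ] [IsProbabilityMeasure ν]
    (hμ : μ = Measure.pi fun t => μ.map fun x => x t)
    (hatom : ∀ (t : Fin N) (a : ℝ), (μ.map fun x => x t) {a} = 0) :
    knotheRosenblatt μ ν = μ.map fun x => (x, knotheRosenblattMap μ ν x) := by
  have hT := measurable_knotheRosenblattMap μ ν
  have h : (uniformCube N).map (fun u => (quantileTransform μ u, quantileTransform ν u)) =
      ((uniformCube N).map (quantileTransform μ)).map fun x => (x, knotheRosenblattMap μ ν x) := by
    rw [Measure.map_map (by fun_prop) (measurable_quantileTransform μ)]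
    refine Measure.map_congr ?_
    filter_upwards [ae_knotheRosenblattMap_quantileTransform ν hμ hatom] with u hu
    simp [hu]
  rw [knotheRosenblatt, h, map_quantileTransform]

end

/-! ### Causal plans from a product law: independence, resampling, lower bound. -/

section

variable {N : ℕ}

/-- Causality at time r - 1, rephrased with strict pasts. At r = 0 there is no earlier time, but the
past is a single point and the claim is trivial. -/
theorem IsCausal.exists_condKernel_eq_past {γ : Measure (Path N × Path N)}
    [IsProbabilityMeasure γ] (hγ : IsCausal γ) (r : Fin N) {E : Set (Iio r → ℝ)}
    (hE : MeasurableSet E) :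
    ∃ g : (Iio r → ℝ) → ℝ≥0∞, Measurable g ∧
      (fun x => γ.condKernel x (past r ⁻¹' E)) =ᵐ[γ.fst] fun x => g (past r x) := by
  by_cases hr : r.val = 0
  · have : IsEmpty (Iio r) := ⟨fun i => by
      have := Fin.lt_def.1 i.2
      omega⟩
    rcases Subsingleton.eq_empty_or_singleton (s := E) (fun a _ b _ => Subsingleton.elim a b)
      with rfl | ⟨a, rfl⟩
    · exact ⟨fun _ => 0, measurable_const, by simp⟩
    · refine ⟨fun _ => 1, measurable_const, ae_of_all _ fun x => ?_⟩
      have : past r ⁻¹' {a} = (univ : Set (Path N)) := by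
        ext x
        simp [Subsingleton.elim (past r x) a]
      simp [this]
  · let t : Fin N := ⟨r.val - 1, by omega⟩
    have htr : ∀ i : Fin N, i ≤ t ↔ i < r := fun i => by
      rw [Fin.le_def, Fin.lt_def]
      simp only [t]
      omega
    let conv : (Iic t → ℝ) → Iio r → ℝ := fun z i => z ⟨i.1, (htr i.1).2 i.2⟩
    have hconv : Measurable conv := measurable_pi_lambda _ fun i => measurable_pi_apply _
    obtain ⟨g, hg, hgγ⟩ := hγ t (past r ⁻¹' E) ⟨conv ⁻¹' E, hE.preimage hconv, rfl⟩
    have hgm : Measurable g := hg.mono ((Filtration.piLE (X := fun _ : Fin N => ℝ)).le t) le_rfl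
    refine ⟨fun a => g (extendPast r a), hgm.comp (measurable_extendPast r), hgγ.trans ?_⟩
    refine ae_of_all _ fun x => ?_
    -- Measurability for the coordinates up to t forces g to be constant on paths agreeing there, so
    -- padding with zeros does not change its value.
    refine Measurable.factorsThrough hg ?_
    ext i
    exact (extendPast_past ((htr i.1).1 i.2) x).symm

/-- Under a causal plan with a product law as first marginal, the coordinate `r` of the first path
is independent of the past before `r` of the second one. -/
theorem IsCausal.map_past_prod {γ : Measure (Path N × Path N)} [IsProbabilityMeasure γ]
    (hγ : IsCausal γ) {μ : Measure (Path N)} [IsProbabilityMeasure μ] (hfst : γ.fst = μ)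
    (hμ : μ = Measure.pi fun t => μ.map fun x => x t) (r : Fin N) :
    γ.map (fun p => (past r p.2, p.1 r)) =
      (γ.map fun p => past r p.2).prod (μ.map fun x => x r) := by
  symm
  have hpm : Measurable fun p : Path N × Path N => past r p.2 := by fun_prop
  have := Measure.isProbabilityMeasure_map (μ := γ) hpm.aemeasurable
  refine Measure.prod_eq fun E A hE hA => ?_
  obtain ⟨g, hg, hgγ⟩ := hγ.exists_condKernel_eq_past r hE
  have hEm : MeasurableSet (past r ⁻¹' E) := hE.preimage (measurable_past r)
  have hAm : MeasurableSet {x : Path N | x r ∈ A} := hA.preimage (measurable_pi_apply r)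
  rw [hfst] at hgγ
  have hset : ∀ C : Set (Path N), MeasurableSet C →
      γ (C ×ˢ (past r ⁻¹' E)) = ∫⁻ x in C, g (past r x) ∂μ := by
    intro C hC
    rw [← Measure.setLIntegral_condKernel_eq_measure_prod hC hEm, hfst]
    exact lintegral_congr_ae (ae_restrict_of_ae hgγ)
  have hc := compatFrom_pi (fun t => μ.map fun x => x t)
  rw [← hμ] at hc
  -- Under μ the coordinate x_r is independent of x_{<r}, so the conditional probability g of the
  -- y-event factors from the indicator of x_r ∈ A.
  have h1 := hc r (Nat.zero_le _) (fun p => g p.1 * A.indicator 1 p.2)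
    ((hg.comp measurable_fst).mul ((measurable_one.indicator hA).comp measurable_snd))
  rw [Measure.map_apply (by fun_prop) (hE.prod hA), Measure.map_apply hpm hE]
  have e1 : (fun p : Path N × Path N => (past r p.2, p.1 r)) ⁻¹' E ×ˢ A =
      {x : Path N | x r ∈ A} ×ˢ (past r ⁻¹' E) := by
    ext p
    simp [and_comm]
  have e2 : (fun p : Path N × Path N => past r p.2) ⁻¹' E = univ ×ˢ (past r ⁻¹' E) := by
    ext p
    simp
  rw [e1, e2, hset _ hAm, hset _ MeasurableSet.univ, setLIntegral_univ]
  calc ∫⁻ x in {x : Path N | x r ∈ A}, g (past r x) ∂μ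
      = ∫⁻ x, g (past r x) * A.indicator 1 (x r) ∂μ := by
        rw [← lintegral_indicator hAm]
        refine lintegral_congr fun x => ?_
        by_cases hx : x r ∈ A <;> simp [hx]
    _ = ∫⁻ x, g (past r x) * (μ.map fun x => x r) A ∂μ := by
        refine h1.trans (lintegral_congr fun x => ?_)
        rw [Kernel.const_apply]
        dsimp only
        rw [lintegral_const_mul _ (measurable_one.indicator hA), lintegral_indicator_one hA]
    _ = _ := lintegral_mul_const _ (hg.comp (measurable_past r))

theorem IsCausal.lintegral_past {γ : Measure (Path N × Path N)} [IsProbabilityMeasure γ]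
    (hγ : IsCausal γ) {μ : Measure (Path N)} [IsProbabilityMeasure μ] (hfst : γ.fst = μ)
    (hμ : μ = Measure.pi fun t => μ.map fun x => x t) (r : Fin N)
    {F : (Iio r → ℝ) × ℝ → ℝ≥0∞} (hF : Measurable F) :
    ∫⁻ p, F (past r p.2, p.1 r) ∂γ =
      ∫⁻ y, ∫⁻ z, F (past r y, z) ∂(μ.map fun x => x r) ∂γ.snd := by
  have hG : Measurable fun y => ∫⁻ z, F (y, z) ∂(μ.map fun x => x r) := hF.lintegral_prod_right'
  have hG' : Measurable fun y : Path N => ∫⁻ z, F (past r y, z) ∂(μ.map fun x => x r) :=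
    hG.comp (measurable_past r)
  rw [← lintegral_map (f := F) hF (by fun_prop), hγ.map_past_prod hfst hμ r,
    lintegral_prod _ hF.aemeasurable, lintegral_map hG (by fun_prop), Measure.snd,
    lintegral_map hG' measurable_snd]

/-- The coordinates of a path up to and including time `r`. -/
def upTo (r : Fin N) (x : Path N) : Iic r → ℝ := fun i => x i

@[fun_prop]
theorem measurable_upTo (r : Fin N) : Measurable (upTo r) :=
  measurable_pi_lambda _ fun i => measurable_pi_apply i.1

/-- The conditional law under `γ` of the coordinate `t` of the first path given the second path up
to time `t`. -/
noncomputable def backwardKernel (γ : Measure (Path N × Path N)) [IsFiniteMeasure γ] (t : Fin N) :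
    Kernel (Iic t → ℝ) ℝ :=
  condDistrib (fun p : Path N × Path N => p.1 t) (fun p => upTo t p.2) γ

instance (γ : Measure (Path N × Path N)) [IsFiniteMeasure γ] (t : Fin N) :
    IsMarkovKernel (backwardKernel γ t) := by
  unfold backwardKernel
  infer_instance

theorem lintegral_backwardKernel (γ : Measure (Path N × Path N)) [IsFiniteMeasure γ] (t : Fin N)
    {F : (Iic t → ℝ) × ℝ → ℝ≥0∞} (hF : Measurable F) :
    ∫⁻ y, ∫⁻ z, F (upTo t y, z) ∂(backwardKernel γ t (upTo t y)) ∂γ.snd =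
      ∫⁻ p, F (upTo t p.2, p.1 t) ∂γ := by
  have h : (γ.map fun p => upTo t p.2) ⊗ₘ backwardKernel γ t =
      γ.map fun p => (upTo t p.2, p.1 t) :=
    compProd_map_condDistrib (X := fun p : Path N × Path N => upTo t p.2)
      (Y := fun p : Path N × Path N => p.1 t) (by fun_prop)
  have hG : Measurable fun a => ∫⁻ z, F (a, z) ∂(backwardKernel γ t a) :=
    hF.lintegral_kernel_prod_right'
  have hG' : Measurable fun y : Path N => ∫⁻ z, F (upTo t y, z) ∂(backwardKernel γ t (upTo t y)) :=
    hG.comp (measurable_upTo t)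
  rw [← lintegral_map (f := F) hF (by fun_prop), ← h, Measure.lintegral_compProd hF,
    lintegral_map hG (by fun_prop), Measure.snd, lintegral_map hG' measurable_snd]

/-- Sampling of the coordinates of the first path from the backward kernels of `γ`, independently
given the second path `q.1`, driven by the noise `q.2`. -/
noncomputable def resample (γ : Measure (Path N × Path N)) [IsFiniteMeasure γ]
    (q : Path N × Path N) : Path N :=
  fun t => quantile (backwardKernel γ t (upTo t q.1)) (q.2 t)

@[fun_prop]
theorem measurable_resample (γ : Measure (Path N × Path N)) [IsFiniteMeasure γ] :
    Measurable (resample γ) :=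
  measurable_pi_lambda _ fun t => (measurable_quantile_kernel (backwardKernel γ t)).comp
    (f := fun q : Path N × Path N => (upTo t q.1, q.2 t)) (by fun_prop)

/-- Resampling x_i reads y only up to i, so x_{<r} is a function of y_{<r} and w_{<r}. -/
theorem past_resample (γ : Measure (Path N × Path N)) [IsFiniteMeasure γ] (r : Fin N)
    (y w : Path N) : past r (resample γ (y, w)) =
      past r (resample γ (extendPast r (past r y), extendPast r (past r w))) := by
  ext i
  have h : upTo i.1 (extendPast r (past r y)) = upTo i.1 y := by
    ext j
    exact extendPast_past (lt_of_le_of_lt j.2 i.2) y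
  change quantile (backwardKernel γ i (upTo i y)) (w i) = quantile (backwardKernel γ i
    (upTo i (extendPast r (past r y)))) (extendPast r (past r w) i)
  rw [h, extendPast_past i.2]

/-- The plan under which the second path has the law it has under `γ` and the coordinates of the
first path are sampled independently from the backward kernels. -/
noncomputable def resampledPlan (γ : Measure (Path N × Path N)) [IsFiniteMeasure γ] :
    Measure (Path N × Path N) :=
  (γ.snd.prod (uniformCube N)).map fun q => (resample γ q, q.1)

instance (γ : Measure (Path N × Path N)) [IsProbabilityMeasure γ] :
    IsProbabilityMeasure (resampledPlan γ) :=
  Measure.isProbabilityMeasure_map (by fun_prop)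

theorem snd_resampledPlan (γ : Measure (Path N × Path N)) [IsProbabilityMeasure γ] :
    (resampledPlan γ).snd = γ.snd := by
  rw [resampledPlan, Measure.snd_map_prodMk (by fun_prop)]
  exact Measure.fst_prod

theorem lintegral_uniformCube_eval (t : Fin N) {F : ℝ → ℝ≥0∞} (hF : Measurable F) :
    ∫⁻ w, F (w t) ∂uniformCube N = ∫⁻ v, F v ∂unif := by
  have h : MeasurePreserving (Function.eval t) (uniformCube N) unif :=
    measurePreserving_eval (fun _ : Fin N => unif) t
  exact h.lintegral_comp hF

/-- Resampling does not change the joint law of simultaneous coordinates. -/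
theorem lintegral_resampledPlan (γ : Measure (Path N × Path N)) [IsProbabilityMeasure γ]
    (t : Fin N) {F : ℝ × ℝ → ℝ≥0∞} (hF : Measurable F) :
    ∫⁻ p, F (p.1 t, p.2 t) ∂(resampledPlan γ) = ∫⁻ p, F (p.1 t, p.2 t) ∂γ := by
  rw [resampledPlan, lintegral_map (by fun_prop) (by fun_prop),
    lintegral_prod _ (by fun_prop)]
  refine Eq.trans (lintegral_congr fun y => ?_)
    (lintegral_backwardKernel γ t (F := fun p => F (p.2, p.1 ⟨t, mem_Iic.2 le_rfl⟩)) (by fun_prop))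
  have hq := measurable_quantile (backwardKernel γ t (upTo t y))
  refine (lintegral_uniformCube_eval t
    (F := fun v => F (quantile (backwardKernel γ t (upTo t y)) v, y t)) (by fun_prop)).trans ?_
  exact lintegral_quantile_unif _ (F := fun z => F (z, y t)) (by fun_prop)

/-- Given the frozen earlier noise, the resampled past is a function of y_{<r}, and (y_{<r}, x_r)
has its joint law under γ, which is a product by causality. -/
theorem firstMarkov_resampledPlan {γ : Measure (Path N × Path N)} [IsProbabilityMeasure γ]
    (hγ : IsCausal γ) {μ : Measure (Path N)} [IsProbabilityMeasure μ] (hfst : γ.fst = μ)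
    (hμ : μ = Measure.pi fun t => μ.map fun x => x t) :
    FirstMarkov (fun r => Kernel.const _ (μ.map fun x => x r)) (resampledPlan γ) := by
  intro r F hF
  simp only [Kernel.const_apply]
  have hG : Measurable fun a => ∫⁻ z, F (a, z) ∂(μ.map fun x => x r) := hF.lintegral_prod_right'
  have hG' : Measurable fun p : Path N × Path N =>
      ∫⁻ z, F ((past r p.1, past r p.2), z) ∂(μ.map fun x => x r) :=
    hG.comp (f := fun p : Path N × Path N => (past r p.1, past r p.2)) (by fun_prop)
  have hG'' : Measurable fun q : Path N × Path N =>
      ∫⁻ z, F ((past r (resample γ q), past r q.1), z) ∂(μ.map fun x => x r) :=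
    hG'.comp (f := fun q : Path N × Path N => (resample γ q, q.1)) (by fun_prop)
  rw [resampledPlan, lintegral_map (by fun_prop) (by fun_prop), lintegral_map hG' (by fun_prop),
    lintegral_prod _ (by fun_prop), lintegral_prod_symm _ hG''.aemeasurable]
  set S : (Iio r → ℝ) → (Iio r → ℝ) → (Iio r → ℝ) := fun a b =>
    past r (resample γ (extendPast r a, extendPast r b)) with hS
  have hSm : Measurable fun p : (Iio r → ℝ) × (Iio r → ℝ) => S p.1 p.2 := by fun_prop
  have hpast : ∀ y w, past r (resample γ (y, w)) = S (past r y) (past r w) :=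
    fun y w => past_resample γ r y w
  -- For fixed y, the noise w_r is independent of w_{<r}; integrating it out yields the backward
  -- kernel.
  have step1 : ∀ y, ∫⁻ w, F ((past r (resample γ (y, w)), past r y), resample γ (y, w) r)
      ∂uniformCube N = ∫⁻ w, ∫⁻ z, F ((S (past r y) (past r w), past r y), z)
        ∂(backwardKernel γ r (upTo r y)) ∂uniformCube N := by
    intro y
    simp_rw [hpast]
    have hq := measurable_quantile (backwardKernel γ r (upTo r y))
    have hm : Measurable fun p : (Iio r → ℝ) × ℝ => F ((S (past r y) p.1, past r y),
        quantile (backwardKernel γ r (upTo r y)) p.2) := by fun_prop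
    refine (compatFrom_uniformCube r (Nat.zero_le _) _ hm).trans (lintegral_congr fun w => ?_)
    exact lintegral_quantile_unif (backwardKernel γ r (upTo r y))
      (F := fun z => F ((S (past r y) (past r w), past r y), z)) (by fun_prop)
  have hm2 : Measurable (Function.uncurry fun (y w : Path N) =>
      ∫⁻ z, F ((S (past r y) (past r w), past r y), z) ∂(backwardKernel γ r (upTo r y))) := by
    have hm3 : Measurable fun p : ((Iic r → ℝ) × (Path N × Path N)) × ℝ =>
        F ((S (past r p.1.2.1) (past r p.1.2.2), past r p.1.2.1), p.2) := by fun_prop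
    have hm4 := hm3.lintegral_kernel_prod_right'
      (κ := (backwardKernel γ r).prodMkRight (Path N × Path N))
    exact hm4.comp (f := fun q : Path N × Path N => (upTo r q.1, q)) (by fun_prop)
  rw [lintegral_congr step1, lintegral_lintegral_swap hm2.aemeasurable]
  refine lintegral_congr fun w => ?_
  have hm5 : Measurable fun p : (Iio r → ℝ) × ℝ => F ((S p.1 (past r w), p.1), p.2) := by fun_prop
  let conv : (Iic r → ℝ) → Iio r → ℝ := fun z i => z ⟨i.1, mem_Iic.2 (le_of_lt i.2)⟩
  have hconv : Measurable conv := measurable_pi_lambda _ fun i => measurable_pi_apply _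
  simp_rw [hpast]
  refine Eq.trans ?_ (hγ.lintegral_past hfst hμ r hm5)
  exact lintegral_backwardKernel γ r
    (F := fun p => F ((S (conv p.1) (past r w), conv p.1), p.2)) (by fun_prop)

/-- The noise is independent of y, and for fixed noise x_{<r} is a function of y_{<r}, so it adds no
information on y_r. -/
theorem firstMarkov_swap_resampledPlan (γ : Measure (Path N × Path N)) [IsProbabilityMeasure γ]
    (ν : Measure (Path N)) [IsProbabilityMeasure ν] (hsnd : γ.snd = ν) :
    FirstMarkov (condLaw ν) ((resampledPlan γ).map Prod.swap) := by
  intro r F hF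
  have hmap : (resampledPlan γ).map Prod.swap =
      (ν.prod (uniformCube N)).map fun q => (q.1, resample γ q) := by
    rw [resampledPlan, Measure.map_map measurable_swap (by fun_prop), hsnd]
    rfl
  have hG' : Measurable fun p : Path N × Path N =>
      ∫⁻ z, F ((past r p.1, past r p.2), z) ∂(condLaw ν r (past r p.1)) := by
    have : Measurable fun a : (Iio r → ℝ) × (Iio r → ℝ) =>
        ∫⁻ z, F (a, z) ∂((condLaw ν r).prodMkRight (Iio r → ℝ) a) :=
      hF.lintegral_kernel_prod_right'
    exact this.comp (f := fun p : Path N × Path N => (past r p.1, past r p.2)) (by fun_prop)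
  have hG'' : Measurable fun q : Path N × Path N =>
      ∫⁻ z, F ((past r q.1, past r (resample γ q)), z) ∂(condLaw ν r (past r q.1)) :=
    hG'.comp (f := fun q : Path N × Path N => (q.1, resample γ q)) (by fun_prop)
  rw [hmap, lintegral_map (by fun_prop) (by fun_prop), lintegral_map hG' (by fun_prop),
    lintegral_prod_symm _ (by fun_prop), lintegral_prod_symm _ hG''.aemeasurable]
  refine lintegral_congr fun w => ?_
  set S : (Iio r → ℝ) → (Iio r → ℝ) → (Iio r → ℝ) := fun a b =>
    past r (resample γ (extendPast r a, extendPast r b)) with hS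
  have hSm : Measurable fun p : (Iio r → ℝ) × (Iio r → ℝ) => S p.1 p.2 := by fun_prop
  have hpast : ∀ y w, past r (resample γ (y, w)) = S (past r y) (past r w) :=
    fun y w => past_resample γ r y w
  simp_rw [hpast]
  exact compatFrom_condLaw ν r (Nat.zero_le _)
    (fun p => F ((p.1, S p.1 (past r w)), p.2)) (by fun_prop)

theorem mem_causalPlans_of_firstMarkov {κ : ∀ r : Fin N, Kernel (Iio r → ℝ) ℝ}
    [∀ r, IsMarkovKernel (κ r)] {γ : Measure (Path N × Path N)} [hP : IsProbabilityMeasure γ]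
    {μ ν : Measure (Path N)} [IsProbabilityMeasure μ] (h : FirstMarkov κ γ)
    (hμ : CompatFrom κ 0 μ) (hν : γ.snd = ν) : γ ∈ causalPlans μ ν :=
  ⟨hP, eq_of_compatFrom_zero h.compatFrom_fst hμ, hν, isCausal_of_firstMarkov h⟩

theorem resampledPlan_mem_bicausalPlans {γ : Measure (Path N × Path N)} [IsProbabilityMeasure γ]
    (hγ : IsCausal γ) {μ ν : Measure (Path N)} [IsProbabilityMeasure μ] [IsProbabilityMeasure ν]
    (hfst : γ.fst = μ) (hsnd : γ.snd = ν) (hμ : μ = Measure.pi fun t => μ.map fun x => x t) :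
    resampledPlan γ ∈ bicausalPlans μ ν := by
  have hc := compatFrom_pi (fun t => μ.map fun x => x t)
  rw [← hμ] at hc
  have h1 : resampledPlan γ ∈ causalPlans μ ν :=
    mem_causalPlans_of_firstMarkov (firstMarkov_resampledPlan hγ hfst hμ) hc
      ((snd_resampledPlan γ).trans hsnd)
  refine ⟨h1, ?_⟩
  have := Measure.isProbabilityMeasure_map (μ := resampledPlan γ) measurable_swap.aemeasurable
  refine mem_causalPlans_of_firstMarkov (firstMarkov_swap_resampledPlan γ ν hsnd)
    (compatFrom_condLaw ν) ?_
  rw [Measure.snd_map_swap]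
  exact h1.choose_spec.1

theorem ae_condDistrib_fst_snd {γ : Measure (Path N × Path N)} [IsProbabilityMeasure γ]
    (hγ : IsCausal γ) {μ ν : Measure (Path N)} [IsProbabilityMeasure μ] [IsProbabilityMeasure ν]
    (hfst : γ.fst = μ) (hsnd : γ.snd = ν) (hμ : μ = Measure.pi fun t => μ.map fun x => x t)
    (t : Fin N) :
    ∀ᵐ a ∂(γ.map fun p => past t p.2),
      (condDistrib (fun p : Path N × Path N => (p.1 t, p.2 t)) (fun p => past t p.2) γ a).fst =
        (μ.map fun x => x t) ∧
      (condDistrib (fun p : Path N × Path N => (p.1 t, p.2 t)) (fun p => past t p.2) γ a).snd =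
        condLaw ν t a := by
  have hY : Measurable fun p : Path N × Path N => (p.1 t, p.2 t) := by fun_prop
  have h1 := condDistrib_comp (μ := γ) (mβ := inferInstance) (fun p => past t p.2) hY.aemeasurable measurable_fst
  have h2 := condDistrib_comp (μ := γ) (mβ := inferInstance) (fun p => past t p.2) hY.aemeasurable measurable_snd
  have h3 : condDistrib (fun p : Path N × Path N => p.1 t) (fun p => past t p.2) γ
      =ᵐ[γ.map fun p => past t p.2] Kernel.const _ (μ.map fun x => x t) := by
    refine condDistrib_ae_eq_of_measure_eq_compProd _ (by fun_prop) ?_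
    rw [hγ.map_past_prod hfst hμ t, Measure.compProd_const]
  have h4 : condDistrib (fun p : Path N × Path N => p.2 t) (fun p => past t p.2) γ
      =ᵐ[γ.map fun p => past t p.2] condLaw ν t := by
    refine condDistrib_ae_eq_of_measure_eq_compProd _ (by fun_prop) ?_
    have e1 : γ.map (fun p => past t p.2) = ν.map (past t) := by
      rw [← hsnd, Measure.snd, Measure.map_map (measurable_past t) measurable_snd]
      rfl
    have e2 : γ.map (fun p => (past t p.2, p.2 t)) = ν.map fun y => (past t y, y t) := by
      rw [← hsnd, Measure.snd, Measure.map_map (by fun_prop) measurable_snd]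
      rfl
    rw [e1, e2]
    exact (compProd_map_condDistrib (X := past t) (measurable_pi_apply t).aemeasurable).symm
  filter_upwards [h1, h2, h3, h4] with a ha1 ha2 ha3 ha4
  rw [Kernel.map_apply _ measurable_fst] at ha1
  rw [Kernel.map_apply _ measurable_snd] at ha2
  refine ⟨?_, ?_⟩
  · rw [Measure.fst, ← ha1]
    exact ha3
  · rw [Measure.snd, ← ha2]
    exact ha4

/-- The noise u_t is independent of Y*_{<t} and drives both quantiles at time t, so the cost of
coordinate t is a ν-average of comonotone costs. -/
theorem lintegral_knotheRosenblatt_sub {μ ν : Measure (Path N)} [IsProbabilityMeasure μ]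
    [IsProbabilityMeasure ν] (hμ : μ = Measure.pi fun t => μ.map fun x => x t) (t : Fin N)
    {f : ℝ → ℝ≥0∞} (hf : Measurable f) :
    ∫⁻ p, f (p.1 t - p.2 t) ∂knotheRosenblatt μ ν =
      ∫⁻ y, ∫⁻ v, f (quantile (μ.map fun x => x t) v - quantile (condLaw ν t (past t y)) v) ∂unif
        ∂ν := by
  have hY := measurable_quantileTransform ν
  have hq := measurable_quantile (μ.map fun x => x t)
  have hqk := measurable_quantile_kernel (condLaw ν t)
  have hm : Measurable fun p : (Iio t → ℝ) × ℝ =>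
      f (quantile (μ.map fun x => x t) p.2 - quantile (condLaw ν t p.1) p.2) := by fun_prop
  have hG : Measurable fun a => ∫⁻ v,
      f (quantile (μ.map fun x => x t) v - quantile (condLaw ν t a) v) ∂unif :=
    hm.lintegral_prod_right'
  have hG' : Measurable fun y : Path N => ∫⁻ v,
      f (quantile (μ.map fun x => x t) v - quantile (condLaw ν t (past t y)) v) ∂unif :=
    hG.comp (measurable_past t)
  rw [knotheRosenblatt, lintegral_map (by fun_prop) (measurable_quantileTransform_prod μ ν)]
  have e1 : ∀ᵐ u ∂uniformCube N, f (quantileTransform μ u t - quantileTransform ν u t) =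
      f (quantile (μ.map fun x => x t) (u t) -
        quantile (condLaw ν t (past t (quantileTransform ν (extendPast t (past t u))))) (u t)) := by
    filter_upwards [ae_condLaw_quantileTransform_of_pi hμ] with u hu
    rw [quantileTransform_eq μ, hu t, quantileTransform_eq ν u t, past_quantileTransform ν t u]
  rw [lintegral_congr_ae e1]
  have hm2 : Measurable fun p : (Iio t → ℝ) × ℝ => f (quantile (μ.map fun x => x t) p.2 -
      quantile (condLaw ν t (past t (quantileTransform ν (extendPast t p.1)))) p.2) :=
    hm.comp (f := fun p : (Iio t → ℝ) × ℝ =>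
      (past t (quantileTransform ν (extendPast t p.1)), p.2)) (by fun_prop)
  refine (compatFrom_uniformCube t (Nat.zero_le _) _ hm2).trans ?_
  have h := lintegral_map (μ := uniformCube N) hG' hY
  rw [map_quantileTransform] at h
  rw [h]
  refine lintegral_congr fun u => ?_
  rw [past_quantileTransform ν t u]
  rfl

/-- In each coordinate, the Knothe–Rosenblatt rearrangement does at least as well as any causal
plan. -/
theorem lintegral_knotheRosenblatt_le {γ : Measure (Path N × Path N)} [IsProbabilityMeasure γ]
    (hγ : IsCausal γ) {μ ν : Measure (Path N)} [IsProbabilityMeasure μ] [IsProbabilityMeasure ν]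
    (hfst : γ.fst = μ) (hsnd : γ.snd = ν) (hμ : μ = Measure.pi fun t => μ.map fun x => x t)
    (t : Fin N) {f : ℝ → ℝ≥0∞} (hf : Measurable f) (hopt : ComonotoneOptimal f) :
    ∫⁻ p, f (p.1 t - p.2 t) ∂knotheRosenblatt μ ν ≤ ∫⁻ p, f (p.1 t - p.2 t) ∂γ := by
  have hm : Measurable fun p : (Iio t → ℝ) × ℝ =>
      f (quantile (μ.map fun x => x t) p.2 - quantile (condLaw ν t p.1) p.2) := by
    have hq := measurable_quantile (μ.map fun x => x t)
    have hqk := measurable_quantile_kernel (condLaw ν t)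
    fun_prop
  have hG : Measurable fun a => ∫⁻ v,
      f (quantile (μ.map fun x => x t) v - quantile (condLaw ν t a) v) ∂unif :=
    hm.lintegral_prod_right'
  set K := condDistrib (fun p : Path N × Path N => (p.1 t, p.2 t)) (fun p => past t p.2) γ
  have e1 : γ.map (fun p => past t p.2) = ν.map (past t) := by
    rw [← hsnd, Measure.snd, Measure.map_map (measurable_past t) measurable_snd]
    rfl
  have hcomp : (γ.map fun p => past t p.2) ⊗ₘ K = γ.map fun p => (past t p.2, (p.1 t, p.2 t)) :=
    compProd_map_condDistrib (X := fun p : Path N × Path N => past t p.2)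
      (Y := fun p : Path N × Path N => (p.1 t, p.2 t)) (by fun_prop)
  have e2 : ∫⁻ p, f (p.1 t - p.2 t) ∂γ =
      ∫⁻ a, ∫⁻ q, f (q.1 - q.2) ∂(K a) ∂(γ.map fun p => past t p.2) := by
    have := Measure.lintegral_compProd (μ := γ.map fun p => past t p.2) (κ := K)
      (f := fun q => f (q.2.1 - q.2.2)) (by fun_prop)
    rw [← this, hcomp, lintegral_map (by fun_prop) (by fun_prop)]
  rw [lintegral_knotheRosenblatt_sub hμ t hf, e2, ← lintegral_map hG (measurable_past t), ← e1]
  -- Both sides are now integrals over y_{<t}; for almost every past K a couples the two laws whose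
  -- comonotone coupling stands on the left.
  refine lintegral_mono_ae ?_
  filter_upwards [ae_condDistrib_fst_snd hγ hfst hsnd hμ t] with a ha
  have h := hopt (K a)
  rwa [ha.1, ha.2] at h

end

/-! ### Extended-real costs: shifting to nonnegative summands. -/

section

open Filter Topology
open scoped NNReal

/-- The decomposition of a into positive and negative parts, written without subtraction so that it
survives a = ⊤. -/
theorem toENNReal_add_eq_of_add_eq {a : EReal} {b : ℝ≥0∞} {k : ℝ≥0}
    (h : a + ((k : ℝ) : EReal) = b) : a.toENNReal + k = b + (-a).toENNReal := by
  induction a with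
  | bot =>
    have : (0 : EReal) ≤ b := EReal.coe_ennreal_nonneg b
    rw [← h] at this
    simp at this
  | top =>
    have : b = ⊤ := by
      rw [EReal.top_add_coe] at h
      exact EReal.coe_ennreal_eq_top_iff.1 h.symm
    simp [this]
  | coe a =>
    have hb : b = ENNReal.ofReal (a + k) := by
      have h' : ((a + k : ℝ) : EReal) = b := by rw [← h, EReal.coe_add]
      rw [← EReal.toENNReal_coe (x := b), ← h', EReal.real_coe_toENNReal]
    have h0 : 0 ≤ a + k := by
      have : (0 : EReal) ≤ b := EReal.coe_ennreal_nonneg b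
      rw [← h] at this
      exact_mod_cast this
    rw [hb, ← EReal.coe_neg, EReal.real_coe_toENNReal, EReal.real_coe_toENNReal,
      ← ENNReal.ofReal_coe_nnreal]
    rcases le_total 0 a with ha | ha
    · rw [ENNReal.ofReal_of_nonpos (neg_nonpos.2 ha), add_zero,
        ENNReal.ofReal_add ha (NNReal.coe_nonneg k)]
    · rw [ENNReal.ofReal_of_nonpos ha, zero_add, ← ENNReal.ofReal_add h0 (neg_nonneg.2 ha)]
      simp

/-- The negative part integrates to at most k, so ⊤ - ⊤ cannot occur. Comparing costs reduces to
comparing integrals of nonnegative functions. -/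
theorem transportCost_eq {Ω : Type*} [MeasurableSpace Ω] {c : Ω → EReal} {f : Ω → ℝ≥0∞}
    (hf : Measurable f) {k : ℝ≥0} (h : ∀ p, c p + ((k : ℝ) : EReal) = f p) (γ : Measure Ω)
    [IsProbabilityMeasure γ] :
    transportCost c γ = ((∫⁻ p, f p ∂γ : ℝ≥0∞) : EReal) - ((k : ℝ) : EReal) := by
  have h1 : ∫⁻ p, (c p).toENNReal ∂γ + k = ∫⁻ p, f p ∂γ + ∫⁻ p, (-c p).toENNReal ∂γ := by
    rw [← lintegral_add_left hf, ← lintegral_congr fun p => toENNReal_add_eq_of_add_eq (h p),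
      lintegral_add_right _ measurable_const]
    simp
  have h2 : ∫⁻ p, (-c p).toENNReal ∂γ ≤ k := by
    calc ∫⁻ p, (-c p).toENNReal ∂γ ≤ ∫⁻ _, (k : ℝ≥0∞) ∂γ := by
          refine lintegral_mono fun p => ?_
          have h0 : (0 : EReal) ≤ c p + ((k : ℝ) : EReal) := by
            rw [h p]
            exact EReal.coe_ennreal_nonneg _
          refine EReal.toENNReal_le_toENNReal (y := ((k : ℝ) : EReal)) ?_ |>.trans ?_
          · rw [EReal.neg_le, ← zero_sub]
            exact EReal.sub_le_of_le_add h0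
          · rw [EReal.toENNReal_of_ne_top (by simp)]
            simp
      _ = k := by simp
  rw [transportCost]
  generalize ∫⁻ p, (c p).toENNReal ∂γ = A at *
  generalize ∫⁻ p, (-c p).toENNReal ∂γ = B at *
  generalize ∫⁻ p, f p ∂γ = S at *
  lift B to ℝ≥0 using (h2.trans_lt ENNReal.coe_lt_top).ne
  rcases eq_or_ne A ⊤ with rfl | hA
  · have : S = ⊤ := by
      rw [top_add] at h1
      exact (ENNReal.add_eq_top.1 h1.symm).resolve_right ENNReal.coe_ne_top
    subst this
    simp only [EReal.coe_ennreal_top]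
    rw [show ((B : ℝ≥0∞) : EReal) = ((B : ℝ) : EReal) from rfl, EReal.top_sub_coe,
      EReal.top_sub_coe]
  · lift A to ℝ≥0 using hA
    have hS : S ≠ ⊤ := by
      rintro rfl
      simp at h1
    lift S to ℝ≥0 using hS
    have h1' : (A : ℝ) + k = S + B := by exact_mod_cast h1
    rw [show ((A : ℝ≥0∞) : EReal) = ((A : ℝ) : EReal) from rfl,
      show ((B : ℝ≥0∞) : EReal) = ((B : ℝ) : EReal) from rfl,
      show ((S : ℝ≥0∞) : EReal) = ((S : ℝ) : EReal) from rfl, ← EReal.coe_sub, ← EReal.coe_sub]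
    congr 1
    linarith

theorem transportCost_top {Ω : Type*} [MeasurableSpace Ω] {c : Ω → EReal} (hc : ∀ p, c p = ⊤)
    (γ : Measure Ω) [IsProbabilityMeasure γ] : transportCost c γ = ⊤ := by
  simp [transportCost, hc]

theorem coe_ennreal_finset_sum {ι : Type*} (s : Finset ι) (f : ι → ℝ≥0∞) :
    ((∑ i ∈ s, f i : ℝ≥0∞) : EReal) = ∑ i ∈ s, (f i : EReal) := by
  classical
  induction s using Finset.induction_on with
  | empty => simp
  | insert i s hi ih => rw [Finset.sum_insert hi, Finset.sum_insert hi, EReal.coe_ennreal_add, ih]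

theorem coe_real_finset_sum {ι : Type*} (s : Finset ι) (f : ι → ℝ) :
    ((∑ i ∈ s, f i : ℝ) : EReal) = ∑ i ∈ s, (f i : EReal) := by
  classical
  induction s using Finset.induction_on with
  | empty => simp
  | insert i s hi ih => rw [Finset.sum_insert hi, Finset.sum_insert hi, EReal.coe_add, ih]

theorem ereal_sum_ne_bot {ι : Type*} (s : Finset ι) {f : ι → EReal} (hf : ∀ i ∈ s, f i ≠ ⊥) :
    ∑ i ∈ s, f i ≠ ⊥ := by
  classical
  induction s using Finset.induction_on with
  | empty => simp
  | insert i s hi ih =>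
    rw [Finset.sum_insert hi, Ne, EReal.add_eq_bot_iff, not_or]
    exact ⟨hf i (Finset.mem_insert_self i s), ih fun j hj => hf j (Finset.mem_insert_of_mem hj)⟩

theorem ereal_sum_ne_top {ι : Type*} (s : Finset ι) {f : ι → EReal} (hf : ∀ i ∈ s, f i ≠ ⊤) :
    ∑ i ∈ s, f i ≠ ⊤ := by
  classical
  induction s using Finset.induction_on with
  | empty => simp
  | insert i s hi ih =>
    rw [Finset.sum_insert hi]
    exact EReal.add_ne_top (hf i (Finset.mem_insert_self i s))
      (ih fun j hj => hf j (Finset.mem_insert_of_mem hj))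

variable {N : ℕ} {c : Path N × Path N → EReal} {c_ : Fin N → ℝ → ℝ → EReal}

theorem summand_ne_bot (hbdd : ∃ K : ℝ, ∀ p, (K : EReal) ≤ c p)
    (hsep : ∀ x y : Path N, c (x, y) = ∑ t, c_ t (x t) (y t)) (t : Fin N) (a b : ℝ) :
    c_ t a b ≠ ⊥ := by
  intro h
  obtain ⟨K, hK⟩ := hbdd
  have h1 := hK (fun _ => a, fun _ => b)
  rw [hsep, ← Finset.add_sum_erase _ _ (Finset.mem_univ t), h, EReal.bot_add] at h1
  exact absurd (le_bot_iff.1 h1) (EReal.coe_ne_bot K)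

theorem continuous_add_toENNReal (r : ℝ) : Continuous fun e : EReal => (e + r).toENNReal := by
  refine EReal.continuous_toENNReal.comp (continuous_iff_continuousAt.2 fun e => ?_)
  exact (EReal.continuousAt_add (p := (e, (r : EReal))) (by simp) (by simp)).comp
    (f := fun e : EReal => (e, (r : EReal))) (by fun_prop)

/-- The summands of a lower semicontinuous separable cost that is bounded below are lower
semicontinuous and bounded below, unless one of them is identically infinite. -/
theorem exists_summand_lsc (hlsc : LowerSemicontinuous c) (hbdd : ∃ K : ℝ, ∀ p, (K : EReal) ≤ c p)
    (hsep : ∀ x y : Path N, c (x, y) = ∑ t, c_ t (x t) (y t))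
    (hfin : ∀ t, ∃ a b, c_ t a b ≠ ⊤) (t : Fin N) :
    ∃ k : ℝ≥0, (∀ a b, 0 ≤ c_ t a b + ((k : ℝ) : EReal)) ∧
      LowerSemicontinuous fun p : ℝ × ℝ => (c_ t p.1 p.2 + ((k : ℝ) : EReal)).toENNReal := by
  have hbot := summand_ne_bot hbdd hsep
  obtain ⟨K, hK⟩ := hbdd
  -- Freezing the other coordinates where their summands are finite, c becomes c_t plus a real
  -- constant R, and c_t inherits bound and semicontinuity.
  choose x₀ y₀ h₀ using hfin
  have hR1 : ∑ s ∈ Finset.univ.erase t, c_ s (x₀ s) (y₀ s) ≠ ⊤ :=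
    ereal_sum_ne_top _ fun s _ => h₀ s
  have hR2 : ∑ s ∈ Finset.univ.erase t, c_ s (x₀ s) (y₀ s) ≠ ⊥ :=
    ereal_sum_ne_bot _ fun s _ => hbot s _ _
  obtain ⟨R, hR⟩ : ∃ R : ℝ, ∑ s ∈ Finset.univ.erase t, c_ s (x₀ s) (y₀ s) = R :=
    ⟨_, (EReal.coe_toReal hR1 hR2).symm⟩
  have hc : ∀ a b, c (Function.update x₀ t a, Function.update y₀ t b) = c_ t a b + R := by
    intro a b
    rw [hsep, ← Finset.add_sum_erase _ _ (Finset.mem_univ t), ← hR]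
    simp only [Function.update_self]
    congr 1
    refine Finset.sum_congr rfl fun s hs => ?_
    rw [Function.update_of_ne (Finset.ne_of_mem_erase hs),
      Function.update_of_ne (Finset.ne_of_mem_erase hs)]
  -- From c_t + R ≥ K one gets c_t + (R - K) ≥ 0.
  refine ⟨(R - K).toNNReal, fun a b => ?_, ?_⟩
  · have h1 := hK (Function.update x₀ t a, Function.update y₀ t b)
    rw [hc] at h1
    have h2 := le_max_left (R - K) 0
    rw [Real.coe_toNNReal']
    rcases eq_or_ne (c_ t a b) ⊤ with htop | htop
    · rw [htop, EReal.top_add_coe]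
      exact le_top
    · obtain ⟨d, hd⟩ : ∃ d : ℝ, c_ t a b = d := ⟨_, (EReal.coe_toReal htop (hbot t a b)).symm⟩
      rw [hd] at h1 ⊢
      have h3 : K ≤ d + R := by exact_mod_cast h1
      have h4 : 0 ≤ d + max (R - K) 0 := by linarith
      exact_mod_cast h4
  · have hcomp : LowerSemicontinuous fun p : ℝ × ℝ =>
        c (Function.update x₀ t p.1, Function.update y₀ t p.2) :=
      hlsc.comp (g := fun p : ℝ × ℝ =>
        (Function.update x₀ t p.1, Function.update y₀ t p.2)) (by fun_prop)
    have := (continuous_add_toENNReal (((R - K).toNNReal : ℝ) - R)).comp_lowerSemicontinuous hcomp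
      (fun e e' hee => EReal.toENNReal_le_toENNReal (by gcongr))
    convert this using 2 with p
    rw [Function.comp_apply, hc, add_assoc, ← EReal.coe_add]
    congr 3
    ring

/-- Comparison of the costs of two plans, coordinate by coordinate. -/
theorem transportCost_le_of_coord (hlsc : LowerSemicontinuous c)
    (hbdd : ∃ K : ℝ, ∀ p, (K : EReal) ≤ c p)
    (hsep : ∀ x y : Path N, c (x, y) = ∑ t, c_ t (x t) (y t))
    {γ γ' : Measure (Path N × Path N)} [IsProbabilityMeasure γ] [IsProbabilityMeasure γ']
    (h : ∀ (t : Fin N) (k : ℝ≥0), (∀ a b, 0 ≤ c_ t a b + ((k : ℝ) : EReal)) →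
      LowerSemicontinuous (fun p : ℝ × ℝ => (c_ t p.1 p.2 + ((k : ℝ) : EReal)).toENNReal) →
      ∫⁻ p, (c_ t (p.1 t) (p.2 t) + ((k : ℝ) : EReal)).toENNReal ∂γ ≤
        ∫⁻ p, (c_ t (p.1 t) (p.2 t) + ((k : ℝ) : EReal)).toENNReal ∂γ') :
    transportCost c γ ≤ transportCost c γ' := by
  by_cases hfin : ∀ t, ∃ a b, c_ t a b ≠ ⊤
  · choose k hk0 hklsc using exists_summand_lsc hlsc hbdd hsep hfin
    have hm : ∀ t, Measurable fun p : Path N × Path N =>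
        (c_ t (p.1 t) (p.2 t) + ((k t : ℝ) : EReal)).toENNReal := fun t =>
      (hklsc t).measurable.comp (f := fun p : Path N × Path N => (p.1 t, p.2 t)) (by fun_prop)
    have hsum : ∀ p : Path N × Path N, c p + (((∑ t, k t : ℝ≥0) : ℝ) : EReal) =
        ((∑ t, (c_ t (p.1 t) (p.2 t) + ((k t : ℝ) : EReal)).toENNReal : ℝ≥0∞) : EReal) := by
      intro p
      rw [coe_ennreal_finset_sum, NNReal.coe_sum, coe_real_finset_sum,
        show c p = c (p.1, p.2) from rfl, hsep, ← Finset.sum_add_distrib]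
      exact Finset.sum_congr rfl fun t _ => (EReal.coe_toENNReal (hk0 t _ _)).symm
    have hms : Measurable fun p : Path N × Path N =>
        ∑ t, (c_ t (p.1 t) (p.2 t) + ((k t : ℝ) : EReal)).toENNReal :=
      Finset.measurable_sum _ fun t _ => hm t
    rw [transportCost_eq hms hsum γ, transportCost_eq hms hsum γ',
      lintegral_finsetSum _ fun t _ => hm t, lintegral_finsetSum _ fun t _ => hm t]
    refine EReal.sub_le_sub ?_ le_rfl
    exact EReal.coe_ennreal_le_coe_ennreal_iff.2 (Finset.sum_le_sum fun t _ => h t (k t) (hk0 t) (hklsc t))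
  -- A summand identically ⊤ makes c identically ⊤, since no summand takes the value ⊥.
  · push Not at hfin
    obtain ⟨t, ht⟩ := hfin
    have hc : ∀ p, c p = ⊤ := by
      rintro ⟨x, y⟩
      rw [hsep, ← Finset.add_sum_erase _ _ (Finset.mem_univ t), ht]
      exact EReal.top_add_of_ne_bot (ereal_sum_ne_bot _ fun s _ => summand_ne_bot hbdd hsep s _ _)
    rw [transportCost_top hc, transportCost_top hc]

theorem toENNReal_convex {h : ℝ → EReal} (hconv : IsConvex h) (hbot : ∀ z, h z ≠ ⊥) (k : ℝ≥0)
    (x y : ℝ) (a b : ℝ≥0) (hab : a + b = 1) (hnn : ∀ z, 0 ≤ h z + ((k : ℝ) : EReal)) :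
    (h (a * x + b * y) + ((k : ℝ) : EReal)).toENNReal ≤
      a * (h x + ((k : ℝ) : EReal)).toENNReal + b * (h y + ((k : ℝ) : EReal)).toENNReal := by
  rcases eq_or_ne a 0 with rfl | ha
  · simp [show b = 1 by simpa using hab]
  rcases eq_or_ne b 0 with rfl | hb
  · simp [show a = 1 by simpa using hab]
  -- Both weights are now positive, so an infinite value makes the right side ⊤.
  rcases eq_or_ne (h x) ⊤ with hx | hx
  · simp [hx, ENNReal.mul_top, ha]
  rcases eq_or_ne (h y) ⊤ with hy | hy
  · simp [hy, ENNReal.mul_top, hb]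
  have hab' : (a : ℝ) + b = 1 := by exact_mod_cast hab
  have hc := hconv x y a b a.2 b.2 hab'
  have hx0 := hnn x
  have hy0 := hnn y
  obtain ⟨r, hr⟩ : ∃ r : ℝ, h x = r := ⟨_, (EReal.coe_toReal hx (hbot x)).symm⟩
  obtain ⟨s, hs⟩ : ∃ s : ℝ, h y = s := ⟨_, (EReal.coe_toReal hy (hbot y)).symm⟩
  rw [hr, hs] at hc
  rw [hr, ← EReal.coe_add] at hx0
  rw [hs, ← EReal.coe_add] at hy0
  have hx1 : 0 ≤ r + k := by exact_mod_cast hx0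
  have hy1 : 0 ≤ s + k := by exact_mod_cast hy0
  have hle : h (a * x + b * y) + ((k : ℝ) : EReal) ≤ ((a * (r + k) + b * (s + k) : ℝ) : EReal) := by
    calc h (a * x + b * y) + ((k : ℝ) : EReal)
        ≤ ((a : ℝ) : EReal) * r + ((b : ℝ) : EReal) * s + ((k : ℝ) : EReal) := by gcongr
      _ = ((a * r + b * s + k : ℝ) : EReal) := by
          rw [EReal.coe_add, EReal.coe_add, EReal.coe_mul, EReal.coe_mul]
      _ = _ := by
          congr 1
          linear_combination (-(k : ℝ)) * hab'
  refine (EReal.toENNReal_le_toENNReal hle).trans (le_of_eq ?_)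
  rw [hr, hs, ← EReal.coe_add, ← EReal.coe_add, EReal.real_coe_toENNReal,
    EReal.real_coe_toENNReal, EReal.real_coe_toENNReal,
    ENNReal.ofReal_add (by positivity) (by positivity),
    ENNReal.ofReal_mul (NNReal.coe_nonneg a), ENNReal.ofReal_mul (NNReal.coe_nonneg b)]
  simp

end

end CausalOT

/-! ### Assembly of the three claims. -/

theorem mainTheorem3 (N : ℕ) (μ ν : Measure (Path N))
    [IsProbabilityMeasure μ] [IsProbabilityMeasure ν]
    (c : Path N × Path N → EReal) (c_ : Fin N → ℝ → ℝ → EReal)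
    (hlsc : LowerSemicontinuous c)
    (hbdd : ∃ K : ℝ, ∀ p, (K : EReal) ≤ c p)
    (hsep : ∀ x y : Path N, c (x, y) = ∑ t, c_ t (x t) (y t))
    (hμ : μ = Measure.pi fun t => μ.map fun x => x t) :
    causalValue c μ ν = bicausalValue c μ ν ∧
    (∀ h : Fin N → ℝ → EReal, (∀ t x y, c_ t x y = h t (x - y)) → (∀ t, IsConvex (h t)) →
      knotheRosenblatt μ ν ∈ causalPlans μ ν ∧
      IsMinOn (transportCost c) (causalPlans μ ν) (knotheRosenblatt μ ν)) ∧
    ((∀ (t : Fin N) (a : ℝ), (μ.map fun x => x t) {a} = 0) →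
      Measurable (knotheRosenblattMap μ ν) ∧ μ.map (knotheRosenblattMap μ ν) = ν ∧
      knotheRosenblatt μ ν = μ.map fun x => (x, knotheRosenblattMap μ ν x)) := by
  refine ⟨le_antisymm ?_ ?_, fun h hch hconv => ⟨knotheRosenblatt_mem_causalPlans μ ν, ?_⟩,
    fun hatom => ⟨measurable_knotheRosenblattMap μ ν, ?_, knotheRosenblatt_eq_map ν hμ hatom⟩⟩
  · exact le_iInf₂ fun γ hγ => iInf₂_le γ hγ.1
  · refine le_iInf₂ fun γ hγ => ?_
    obtain ⟨_, hfst, hsnd, hcausal⟩ := hγ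
    refine (iInf₂_le _ (resampledPlan_mem_bicausalPlans hcausal hfst hsnd hμ)).trans ?_
    refine transportCost_le_of_coord hlsc hbdd hsep fun t k _ hk => ?_
    exact (lintegral_resampledPlan γ t hk.measurable).le
  · rintro γ ⟨_, hfst, hsnd, hcausal⟩
    refine transportCost_le_of_coord hlsc hbdd hsep fun t k hk0 hk => ?_
    simp only [hch] at hk hk0 ⊢
    -- Properties of h_t are read off from c_t on the line where the second variable is 0.
    have hnn : ∀ z, 0 ≤ h t z + ((k : ℝ) : EReal) := fun z => by simpa using hk0 z 0
    have hbot : ∀ z, h t z ≠ ⊥ := fun z => by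
      simpa [hch] using summand_ne_bot hbdd hsep t z 0
    have hlsc' : LowerSemicontinuous fun z => (h t z + ((k : ℝ) : EReal)).toENNReal := by
      simpa [Function.comp_def] using hk.comp (g := fun z : ℝ => (z, (0 : ℝ))) (by fun_prop)
    exact lintegral_knotheRosenblatt_le hcausal hfst hsnd hμ t
      (f := fun z => (h t z + ((k : ℝ) : EReal)).toENNReal) hlsc'.measurable
      (comonotoneOptimal_of_convex_lsc hlsc' fun x y a b hab =>
        toENNReal_convex (hconv t) hbot k x y a b hab hnn)
  · have h := snd_knotheRosenblatt μ ν
    rwa [knotheRosenblatt_eq_map ν hμ hatom, Measure.snd_map_prodMk (X := fun x => x) measurable_id] at h
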